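/- **Setting.** Let $d\ge 1$, $\alpha>0$. Qubits sit on the edges of the periodic lattice $\mathbb Z_L^d$; a bit-flip error is a $\mathbb Z_2$-chain $x$ of edges, anyons are the sites of its boundary $\partial x$ (the syndrome, measured without errors), and the logical action of $x$ is its vector $w(x)\in\mathbb Z_2^d$ of crossing parities with the coordinate hyperplanes (for $d=1$ this is the repetition code, for $d=2$ one sector of the toric code). *Power-law decoder.* At each time step an anyon at $\mathbf r_i$ feels the instantaneous force $\mathbf F_i=\sum_{j\ne i}(\mathbf r_j-\mathbf r_i)/\|\mathbf r_j-\mathbf r_i\|^{\alpha+1}$ (Euclidean norm, shortest periodic displacement) and moves by one site in the direction $\phi(\mathbf F_i)$, where $\phi:\mathbb R^d\to\{\pm\hat{\mathbf a}\}$ is any function that maps each positive multiple of a lattice unit vector to that vector (e.g. the lattice direction with largest inner product with the force, with any tie-breaking). The qubits on all edges crossed are flipped once, so adjacent anyons that move towards each other annihilate. *Noise.* A noise model is the law of a random set $\mathsf N$ of space-time locations (edge, time step); in each step the noise flips its qubits and then the decoder acts. It is $p$-bounded if $\mathsf P(A\subseteq\mathsf N)<p^{|A|}$ for every finite nonempty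 $A$. A family of noise models, one for each $L$, is local if there is $\ell$ independent of $L$ such that the noise histories in any two regions at distance more than $\ell$ are independent. *Memory time.* Let $\mathcal D_{\sf off}$ be an offline decoder (for each $L$, a map from syndromes to corrections with the same syndrome) that has a threshold: for every $p$ below some $p_c>0$ and all $p$-bounded single-shot errors, it fails with probability tending to $0$ as $L\to\infty$. Let $t_{\rm mem}$ be the maximum, over logical basis states $\rho$, of the first time $t$ at which $\|\mathcal D_{\sf off}(\mathcal D_{\mathcal E}^t(\rho))-\rho\|_1>1/2$, where $\mathcal D_{\mathcal E}^t$ is $t$ steps of the decoder under the noise $\mathcal E$. **Theorem (no threshold for power-law decoders).** For every $d\ge1$, every $\alpha>0$, and every $\phi$ and $\mathcal D_{\sf off}$ as above: 1. There are $p$-independent constants $a,b,c>0$ such that for every $p\in(0,1)$ there is a local $p$-bounded noise model, without measurement errors, with $$\limsup_{L\to\infty}t_{\rm mem}<a\,e^{\,b/\ln(1/(1-p))}+c .$$ 2. Consider on the infinite line a pair of anyons at $0$ and $r$, with $r>2$ an integer, together with small noise pairs: for each $n\ge1$ independently, with probability $p\in(0,1)$, there are anyons at $r+3n-1,\ r+3n$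 and at the mirror images $-3n+1,\ -3n$. Let $r'$ be the separation of the large pair after each of its two anyons has moved by one site along the power-law force on it (the force being summed over $n$). Then the bias $b_r=\mathsf P(r'=r+2)-\mathsf P(r'=r-2)$ satisfies $$b_r\ \ge\ 1-2(1-p)^{\lfloor 2^{1/\alpha}3^{-1/\alpha-1}r\rfloor}.$$ -/

import Mathlib

open MeasureTheory ProbabilityTheory Filter Topology
open scoped ENNReal

noncomputable section

namespace PowerLaw

/-! ### The code: `ℤ₂` anyons on a periodic `d`-dimensional lattice of linear size `L` -/

/-- Sites of the `d`-dimensional periodic lattice of linear size `L`; anyons live here. -/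
abbrev Site (d L : ℕ) := Fin d → ZMod L

/-- The edge `(v, a)` joins the sites `v` and `v + e_a`; each edge carries one qubit. -/
abbrev Edge (d L : ℕ) := Site d L × Fin d

/-- Bit-flip patterns: the value at an edge is `1` if the qubit on that edge is flipped. -/
abbrev Chain (d L : ℕ) := Edge d L → ZMod 2

/-- The (noiselessly measured) syndrome of an error: its boundary modulo `2`. Sites where it is
nonzero host an anyon. For `d = 1` the anyons are the domain walls of the repetition code, for
`d = 2` they are the excitations of one sector of the toric code. -/
def syndrome {d L : ℕ} (x : Chain d L) : Site d L → ZMod 2 :=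
  fun v => ∑ a, (x (v, a) + x (v - Pi.single a 1, a))

/-- The logical action of an error without anyons: for each direction `a`, the parity of
the number of times that it crosses the hyperplane at coordinate `0` transverse to `a`. -/
def winding {d L : ℕ} [NeZero L] (x : Chain d L) : Fin d → ZMod 2 :=
  fun a => ∑ v ∈ Finset.univ.filter (fun v : Site d L => v a = 0), x (v, a)

/-! ### The power-law decoder -/

/-- Displacement vector from `v` to `w` on the periodic lattice: each coordinate difference is
represented by its representative of least absolute value, in `(-L/2, L/2]`. -/
def disp {d L : ℕ} (v w : Site d L) : EuclideanSpace ℝ (Fin d) :=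
  WithLp.toLp 2 (fun i => ((w i - v i).valMinAbs : ℝ))

/-- The set of sites that host an anyon. -/
def anyons {d L : ℕ} [NeZero L] (σ : Site d L → ZMod 2) : Finset (Site d L) :=
  Finset.univ.filter (fun v => σ v ≠ 0)

/-- The force `∑_{w ≠ v} (w - v) / ‖w - v‖ ^ (α + 1)` that the anyons `w` exert on an anyon at `v`,
with the Euclidean norm. -/
def force {d L : ℕ} [NeZero L] (α : ℝ) (σ : Site d L → ZMod 2) (v : Site d L) :
    EuclideanSpace ℝ (Fin d) :=
  ∑ w ∈ (anyons σ).erase v, (‖disp v w‖ ^ (α + 1))⁻¹ • disp v w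

/-- Lattice directions: `(a, 1)` is `+e_a` and `(a, -1)` is `-e_a`. -/
abbrev Dir (d : ℕ) := Fin d × ℤˣ

/-- The unit vector of a lattice direction. -/
def dirVec {d : ℕ} (s : Dir d) : EuclideanSpace ℝ (Fin d) :=
  EuclideanSpace.single s.1 ((s.2 : ℤ) : ℝ)

/-- The rule `φ`, which turns forces into lattice directions, sends a nonzero force that points
along a lattice direction to that direction. Nothing is required of `φ` on other forces (nor of
`φ 0`); every `φ` that selects a lattice direction with the largest inner product with the force
is of this kind. -/
def RespectsAxes {d : ℕ} (φ : EuclideanSpace ℝ (Fin d) → Dir d) : Prop :=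
  ∀ (s : Dir d) (c : ℝ), 0 < c → φ (c • dirVec s) = s

/-- The edge that an anyon at `v` crosses when it moves by one site in the direction `s`. -/
def crossedEdge {d L : ℕ} (v : Site d L) (s : Dir d) : Edge d L :=
  if s.2 = 1 then (v, s.1) else (v - Pi.single s.1 1, s.1)

open Classical in
/-- The correction of one decoder step: every anyon moves by one site in the direction selected by
`φ` from the force on it, i.e. the qubits on the edges crossed by an anyon are flipped. An edge is
flipped once also if the two anyons at its endpoints move towards each other; these annihilate. -/
def correction {d L : ℕ} [NeZero L] (α : ℝ) (φ : EuclideanSpace ℝ (Fin d) → Dir d)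
    (σ : Site d L → ZMod 2) : Chain d L :=
  fun e => if ∃ v ∈ anyons σ, crossedEdge v (φ (force α σ v)) = e then 1 else 0

/-! ### Noise -/

/-- A noise realization: the set of space-time locations (qubit, time step) at which the noise acts.
Measurements are not among the locations, so they are perfect. -/
abbrev Noise (d L : ℕ) := Set (Edge d L × ℕ)

/-- A random set of locations is `p`-bounded: `P(A ⊆ N) < p ^ |A|` for all finite nonempty `A`. -/
def PBounded {ι : Type*} (p : ℝ) (μ : Measure (Set ι)) : Prop :=
  ∀ A : Finset ι, A.Nonempty → μ {N | (A : Set ι) ⊆ N} < ENNReal.ofReal p ^ A.card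

/-- Distance of (the base points of) two edges on the periodic lattice, in the maximum norm. -/
def edgeDist {d L : ℕ} (e f : Edge d L) : ℕ :=
  Finset.univ.sup fun i => (f.1 i - e.1 i).valMinAbs.natAbs

/-- A noise model is local with range `ℓ`: the noise histories in two regions at distance larger
than `ℓ` are independent. -/
def LocalRange {d L : ℕ} (l : ℕ) (μ : Measure (Noise d L)) : Prop :=
  ∀ A B : Set (Edge d L), (∀ e ∈ A, ∀ f ∈ B, l < edgeDist e f) →
    IndepFun (fun N : Noise d L => ({z ∈ N | z.1 ∈ A} : Noise d L))
      (fun N : Noise d L => ({z ∈ N | z.1 ∈ B} : Noise d L)) μ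

open Classical in
/-- The indicator chain of a set of edges. -/
def chainOf {d L : ℕ} (S : Set (Edge d L)) : Chain d L := fun e => if e ∈ S then 1 else 0

/-- The accumulated error after `t` time steps of the noisy decoder, started without errors. In each
step the noise acts, the syndrome is measured, and the decoder applies its correction. -/
def state {d L : ℕ} [NeZero L] (α : ℝ) (φ : EuclideanSpace ℝ (Fin d) → Dir d) (N : Noise d L) :
    ℕ → Chain d L
  | 0 => 0
  | t + 1 =>
    (state α φ N t + chainOf {e | (e, t) ∈ N}) +
      correction α φ (syndrome (state α φ N t + chainOf {e | (e, t) ∈ N}))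

/-! ### Offline decoding and memory time -/

/-- The logical error that remains after an error `x` has been decoded offline by `D`. -/
def residual {d L : ℕ} [NeZero L] (D : (Site d L → ZMod 2) → Chain d L) (x : Chain d L) :
    Fin d → ZMod 2 :=
  winding (x + D (syndrome x))

/-- A (noiseless) offline decoder for all system sizes: it returns, for every syndrome that can
occur, a correction with that syndrome. -/
def IsOfflineDecoder {d : ℕ} (D : ∀ L : ℕ+, (Site d L → ZMod 2) → Chain d L) : Prop :=
  ∀ (L : ℕ+) (x : Chain d L), syndrome (D L (syndrome x)) = syndrome x

/-- The offline decoder has a threshold: for all `p` below some `p_c > 0` it corrects every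
`p`-bounded error with probability tending to `1` as `L → ∞`. -/
def HasThreshold {d : ℕ} (D : ∀ L : ℕ+, (Site d L → ZMod 2) → Chain d L) : Prop :=
  ∃ pc : ℝ, 0 < pc ∧ ∀ p : ℝ, 0 < p → p < pc →
    ∀ μ : ∀ L : ℕ+, Measure (Set (Edge d L)),
      (∀ L, IsProbabilityMeasure (μ L)) → (∀ L, PBounded p (μ L)) →
      Tendsto (fun L => (μ L) {S | residual (D L) (chainOf S) ≠ 0}) atTop (𝓝 0)

/-- The distance `‖D_off (D_E ^ t ρ) - ρ‖₁`, for `ρ` the logical basis state with label `k`: the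
`ℓ¹` distance between the law of the label after `t` noisy steps and offline decoding, and the
point mass at `k`. -/
def logicalDist {d L : ℕ} [NeZero L] (α : ℝ) (φ : EuclideanSpace ℝ (Fin d) → Dir d)
    (D : (Site d L → ZMod 2) → Chain d L) (μ : Measure (Noise d L))
    (k : Fin d → ZMod 2) (t : ℕ) : ℝ :=
  ∑ h : Fin d → ZMod 2,
    |μ.real {N | k + residual D (state α φ N t) = h} - if h = k then 1 else 0|

/-- The memory time: the maximum over logical basis states of the first time at which the distance
exceeds `1 / 2` (infinite if it never does). -/
def memoryTime {d L : ℕ} [NeZero L] (α : ℝ) (φ : EuclideanSpace ℝ (Fin d) → Dir d)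
    (D : (Site d L → ZMod 2) → Chain d L) (μ : Measure (Noise d L)) : ℕ∞ :=
  ⨆ k : Fin d → ZMod 2, ⨅ t ∈ {t : ℕ | 1 / 2 < logicalDist α φ D μ k t}, (t : ℕ∞)

/-! ### A single large pair on the infinite line -/

/-- The power-law force on an anyon at `x` due to an anyon at `y`, on the infinite line. -/
def lineForce (α : ℝ) (x y : ℤ) : ℝ := ((y - x : ℤ) : ℝ) / |((y - x : ℤ) : ℝ)| ^ (α + 1)

/-- The anyons of the two small pairs number `n`, mirror images of each other, outside a large pair
with anyons at `0` and `r`. -/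
def smallPairs (r : ℤ) (n : ℕ+) : Finset ℤ :=
  {r + 3 * (n : ℤ) - 1, r + 3 * (n : ℤ), -(3 * (n : ℤ)), -(3 * (n : ℤ)) + 1}

open Classical in
/-- The force on the anyon at `x` (either `0` or `r`) of the large pair, when the noise has created
the small pairs with numbers in `S`. -/
def pairForce (α : ℝ) (r : ℤ) (S : Set ℕ+) (x : ℤ) : ℝ :=
  lineForce α x (r - x) +
    ∑' n : ℕ+, if n ∈ S then ∑ y ∈ smallPairs r n, lineForce α x y else 0

/-- The separation of the large pair after both of its anyons have moved by one site along the
force. -/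
def nextSeparation (α : ℝ) (r : ℤ) (S : Set ℕ+) : ℤ :=
  r + (SignType.sign (pairForce α r S r) : ℤ) - (SignType.sign (pairForce α r S 0) : ℤ)

/-- The bias `P(r → r + 2) - P(r → r - 2)` of the pair separation, when each small pair together
with its mirror image is created independently with probability `p`. -/
def bias (α : ℝ) (p : unitInterval) (r : ℤ) : ℝ :=
  (setBernoulli (Set.univ : Set ℕ+) p).real {S | nextSeparation α r S = r + 2} -
    (setBernoulli (Set.univ : Set ℕ+) p).real {S | nextSeparation α r S = r - 2}

end PowerLaw

end

/-!
# Power-law decoders have no threshold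

*Destroying the memory.* All noise acts on a single lattice line, so the anyons and the forces on
them stay on this line and the decoder acts on a ring of `L` sites, whatever `φ` does with
forces in other directions (`correction_lineChain`). The ring is divided evenly into blocks of
bounded length. In each block the noise creates one large pair of anyons and from then on adds, in
every step, a small pair next to each of its two anyons. If the two are closer than everything
else by a large factor `C`, then the large anyon moves towards the small pair, and the small pair
annihilates (`pair_step`). The noise thereby steers the large pairs at will.

The forces of distant blocks have to be negligible for every `α > 0`, although `∑ 1 / k ^ α` may
diverge. They are, because every block contains the same number of anyons: the force along the ring
is antitone in the displacement, so the force of one anyon per block lies between those of slightly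
shifted, equally spaced arrays, for which opposite contributions cancel (`abs_sum_arcForce_le`,
`mul_sum_ringForce_pos`).

The positions of the small pairs are random, but the effect of the noise is not. Each small pair is
placed at one of `K` equally likely positions, where `1 / K < p`, so that each location is used with
probability `1 / K` only. While the large pair is still short, its small pairs have to be close, and
there are fewer choices for them; the large pair itself is created with certainty. Therefore the
initial position of the large pair in its block is one of `M`, each with its own locations for the
early events, and `M` makes up for all missing choices (`card_subset_slotSet_mul_le`,
`pBounded_noise`). As the number of choices grows in proportion to the length of the pair,
`K ^ K ≤ 4 ^ K * K!` shows that `M = exp (O (K))` suffices (`designOf_entropy`). Different blocks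
are independent, so the noise is local (`localRange_noise`).

When the pair is long, the noise moves it within its block, by a walk of fixed length, to a position
that does not depend on the initial one, and then makes it grow until only short gaps between the
large pairs of adjacent blocks remain (`Design.left`, `state_succ_eq`). Without further noise these
gaps close (`closing_step`), whereupon all qubits of the line are flipped (`state_final`). This
error has the trivial syndrome, and an offline decoder with a threshold answers the trivial syndrome
without a logical error on all large lattices (`eventually_residual_zero`). So the memory is lost with
certainty, at a time that is `exp (O (1 / p))` and independent of `L`, and
`1 / p ≤ 1 + 1 / log (1 / (1 - p))`.

*The bias.* By mirror symmetry the two anyons of the pair feel opposite forces. A small pair never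
pulls inwards, and one whose far anyon is at distance at most `(2 / 3) ^ (1 / α) * r` beats the
attraction of the large pair (`pairForce_right_pos`). With `m` such small pairs available, the pair
fails to grow with probability at most `(1 - p) ^ m` (`le_bias`).
-/

namespace PowerLaw

/-! ### The bias of a single large pair -/

/-- Differences of an antitone nonnegative sequence along a fixed shift telescope. -/
lemma summable_sub_shift_of_antitone {g : ℕ → ℝ} (hg : Antitone g) (h0 : ∀ n, 0 ≤ g n) (k : ℕ) :
    Summable fun n => g n - g (n + k) := by
  refine summable_of_sum_range_le (c := ∑ i ∈ Finset.range k, g i)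
    (fun n => sub_nonneg.2 (hg (Nat.le_add_right n k))) fun N => ?_
  have h1 := Finset.sum_range_add g k N
  have h2 := Finset.sum_range_add g N k
  have h3 : 0 ≤ ∑ i ∈ Finset.range k, g (N + i) := Finset.sum_nonneg fun i _ => h0 _
  rw [Finset.sum_sub_distrib]
  rw [add_comm N k] at h2
  simp only [add_comm _ k] at *
  linarith

lemma lineForce_pos (α : ℝ) {x y : ℤ} (h : x < y) :
    lineForce α x y = ((y - x : ℤ) : ℝ) ^ (-α) := by
  have h0 : (0 : ℝ) < ((y - x : ℤ) : ℝ) := by exact_mod_cast sub_pos.2 h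
  rw [lineForce, abs_of_pos h0, div_eq_iff (by positivity), ← Real.rpow_add h0]
  simp

lemma lineForce_neg (α : ℝ) {x y : ℤ} (h : y < x) :
    lineForce α x y = -((x - y : ℤ) : ℝ) ^ (-α) := by
  rw [← lineForce_pos α h, lineForce, lineForce, ← abs_neg, neg_div']
  push_cast
  ring_nf

lemma lineForce_reflect (α : ℝ) (r x y : ℤ) :
    lineForce α (r - x) (r - y) = -lineForce α x y := by
  rw [lineForce, lineForce, ← abs_neg, neg_div']
  push_cast
  ring_nf

/-- The force of the small pairs number `n` on the right anyon of the large pair. -/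
lemma sum_smallPairs_right (α : ℝ) (r : ℕ) (n : ℕ+) :
    ∑ y ∈ smallPairs r n, lineForce α r y =
      ((3 * n - 1 : ℕ) : ℝ) ^ (-α) + ((3 * n : ℕ) : ℝ) ^ (-α)
        - ((r + 3 * n : ℕ) : ℝ) ^ (-α) - ((r + 3 * n - 1 : ℕ) : ℝ) ^ (-α) := by
  have hn : 1 ≤ (n : ℕ) := n.2
  obtain ⟨m, hm⟩ : ∃ m : ℕ, (n : ℕ) = m + 1 := ⟨n - 1, by omega⟩
  have e1 : lineForce α r (r + 3 * (n : ℤ) - 1) = ((3 * n - 1 : ℕ) : ℝ) ^ (-α) := by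
    rw [lineForce_pos α (by omega), ← Int.cast_natCast (R := ℝ)]; congr 2; omega
  have e2 : lineForce α r (r + 3 * (n : ℤ)) = ((3 * n : ℕ) : ℝ) ^ (-α) := by
    rw [lineForce_pos α (by omega), ← Int.cast_natCast (R := ℝ)]; congr 2; push_cast; omega
  have e3 : lineForce α r (-(3 * (n : ℤ))) = -((r + 3 * n : ℕ) : ℝ) ^ (-α) := by
    rw [lineForce_neg α (by omega), ← Int.cast_natCast (R := ℝ)]; congr 3; omega
  have e4 : lineForce α r (-(3 * (n : ℤ)) + 1) = -((r + 3 * n - 1 : ℕ) : ℝ) ^ (-α) := by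
    rw [lineForce_neg α (by omega), ← Int.cast_natCast (R := ℝ)]; congr 3; omega
  rw [smallPairs, Finset.sum_insert, Finset.sum_insert, Finset.sum_insert, Finset.sum_singleton,
    e1, e2, e3, e4]
  · ring
  all_goals simp only [Finset.mem_insert, Finset.mem_singleton]; omega

lemma rpow_neg_antitone {α : ℝ} (hα : 0 < α) {a b : ℝ} (ha : 0 < a) (hab : a ≤ b) :
    b ^ (-α) ≤ a ^ (-α) :=
  Real.rpow_le_rpow_of_nonpos ha hab (by linarith)

lemma sum_smallPairs_right_nonneg {α : ℝ} (hα : 0 < α) (r : ℕ) (n : ℕ+) :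
    0 ≤ ∑ y ∈ smallPairs r n, lineForce α r y := by
  have hn : 1 ≤ (n : ℕ) := n.2
  rw [sum_smallPairs_right]
  have h1 := rpow_neg_antitone hα (a := ((3 * n - 1 : ℕ) : ℝ)) (b := ((r + 3 * n - 1 : ℕ) : ℝ))
    (Nat.cast_pos.2 (by omega)) (Nat.cast_le.2 (by omega))
  have h2 := rpow_neg_antitone hα (a := ((3 * n : ℕ) : ℝ)) (b := ((r + 3 * n : ℕ) : ℝ))
    (Nat.cast_pos.2 (by omega)) (Nat.cast_le.2 (by omega))
  linarith

/-- The total force of all small pairs converges, for every `α > 0`: the forces of a pair and of its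
mirror image nearly cancel, and their sum telescopes. -/
lemma summable_smallPairs_right {α : ℝ} (hα : 0 < α) (r : ℕ) :
    Summable fun n : ℕ+ => ∑ y ∈ smallPairs r n, lineForce α r y := by
  have key : ∀ j : ℕ, j ≤ 1 → Summable fun n : ℕ =>
      ((3 * n + 2 + j : ℕ) : ℝ) ^ (-α) - ((3 * (n + r) + 2 + j : ℕ) : ℝ) ^ (-α) := by
    intro j _
    refine summable_sub_shift_of_antitone (g := fun n => ((3 * n + 2 + j : ℕ) : ℝ) ^ (-α))
      (fun a b hab => ?_) (fun n => by positivity) r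
    exact rpow_neg_antitone hα (Nat.cast_pos.2 (by omega)) (Nat.cast_le.2 (by omega))
  have h := (((key 0 (by omega)).add (key 1 le_rfl)).comp_injective PNat.natPred_injective)
  refine Summable.of_nonneg_of_le (fun n => sum_smallPairs_right_nonneg hα r n) (fun n => ?_) h
  have hn : 1 ≤ (n : ℕ) := n.2
  have hp : PNat.natPred n = (n : ℕ) - 1 := rfl
  rw [sum_smallPairs_right]
  simp only [Function.comp, hp]
  have h1 := rpow_neg_antitone hα (a := ((r + 3 * n - 1 : ℕ) : ℝ))
    (b := ((3 * ((n : ℕ) - 1 + r) + 2 + 0 : ℕ) : ℝ)) (Nat.cast_pos.2 (by omega))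
    (Nat.cast_le.2 (by omega))
  have h2 := rpow_neg_antitone hα (a := ((r + 3 * n : ℕ) : ℝ))
    (b := ((3 * ((n : ℕ) - 1 + r) + 2 + 1 : ℕ) : ℝ)) (Nat.cast_pos.2 (by omega))
    (Nat.cast_le.2 (by omega))
  have e1 : 3 * ((n : ℕ) - 1) + 2 + 0 = 3 * n - 1 := by omega
  have e2 : 3 * ((n : ℕ) - 1) + 2 + 1 = 3 * n := by omega
  rw [e2, e1]
  linarith

/-- The configuration is invariant under the reflection `x ↦ r - x`, which exchanges the two anyons
of the large pair. -/
lemma pairForce_zero_eq (α : ℝ) (r : ℤ) (S : Set ℕ+) :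
    pairForce α r S 0 = -pairForce α r S r := by
  have h : ∀ n, ∑ y ∈ smallPairs r n, lineForce α 0 y = -∑ y ∈ smallPairs r n, lineForce α r y := by
    intro n
    rw [← Finset.sum_neg_distrib]
    refine Finset.sum_nbij' (fun y => r - y) (fun y => r - y) ?_ ?_ (by simp) (by simp) ?_
    · intro y hy
      simp only [smallPairs, Finset.mem_insert, Finset.mem_singleton] at hy ⊢
      omega
    · intro y hy
      simp only [smallPairs, Finset.mem_insert, Finset.mem_singleton] at hy ⊢
      omega
    · intro y _
      have := lineForce_reflect α r 0 y
      rw [sub_zero] at this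
      linarith
  rw [pairForce, pairForce, neg_add, ← tsum_neg]
  congr 1
  · have := lineForce_reflect α r r 0
    simpa using this
  · congr 1
    ext n
    split_ifs
    · exact h n
    · simp

/-- The sign of the force on the right anyon decides the next separation. -/
lemma nextSeparation_eq (α : ℝ) (r : ℤ) (S : Set ℕ+) :
    nextSeparation α r S = r + 2 * (SignType.sign (pairForce α r S r) : ℤ) := by
  rw [nextSeparation, pairForce_zero_eq, Left.sign_neg, SignType.coe_neg]
  ring

/-- A single small pair at distance at most `(2 / 3) ^ (1 / α) * r` beats the attraction of the
large pair, since the other small pairs never pull inwards. -/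
lemma pairForce_right_pos {α : ℝ} (hα : 0 < α) {r : ℕ} (hr : 0 < r) {S : Set ℕ+} {n : ℕ+}
    (hn : n ∈ S) (h : (3 * n : ℝ) ≤ (2 / 3 : ℝ) ^ (1 / α) * r) : 0 < pairForce α r S r := by
  classical
  have hn1 : 1 ≤ (n : ℕ) := n.2
  have hs : Summable fun m : ℕ+ =>
      if m ∈ S then ∑ y ∈ smallPairs r m, lineForce α r y else 0 := by
    refine Summable.of_nonneg_of_le (fun m => ?_) (fun m => ?_) (summable_smallPairs_right hα r)
    · split_ifs
      exacts [sum_smallPairs_right_nonneg hα r m, le_rfl]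
    · split_ifs
      exacts [le_rfl, sum_smallPairs_right_nonneg hα r m]
  have h1 := hs.le_tsum n (fun m _ => by
    split_ifs
    exacts [sum_smallPairs_right_nonneg hα r m, le_rfl])
  rw [if_pos hn, sum_smallPairs_right] at h1
  have h2 : lineForce α r (r - r) = -(r : ℝ) ^ (-α) := by
    rw [lineForce_neg α (by omega)]; simp
  have hr' : (0 : ℝ) < r := by exact_mod_cast hr
  have h3 : (3 / 2 : ℝ) * (r : ℝ) ^ (-α) ≤ ((3 * n : ℕ) : ℝ) ^ (-α) := by
    have := rpow_neg_antitone hα (a := ((3 * n : ℕ) : ℝ)) (by positivity)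
      (by push_cast; exact h)
    refine le_trans (le_of_eq ?_) this
    rw [Real.mul_rpow (by positivity) hr'.le, ← Real.rpow_mul (by norm_num)]
    congr 1
    have : 1 / α * -α = -1 := by field_simp
    rw [this, Real.rpow_neg_one]; norm_num
  have h4 := rpow_neg_antitone hα (a := ((3 * n - 1 : ℕ) : ℝ)) (b := ((3 * n : ℕ) : ℝ))
    (Nat.cast_pos.2 (by omega)) (Nat.cast_le.2 (by omega))
  have h5 : ((r + 3 * n : ℕ) : ℝ) ^ (-α) < (r : ℝ) ^ (-α) :=
    Real.rpow_lt_rpow_of_neg hr' (Nat.cast_lt.2 (by omega)) (by linarith)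
  have h6 : ((r + 3 * n - 1 : ℕ) : ℝ) ^ (-α) < (r : ℝ) ^ (-α) :=
    Real.rpow_lt_rpow_of_neg hr' (Nat.cast_lt.2 (by omega)) (by linarith)
  unfold pairForce
  rw [h2]
  linarith

/-- The probability that a Bernoulli random set misses a given finite set. -/
lemma setBernoulli_univ_disjoint {ι : Type*} (p : unitInterval) (u : Finset ι) :
    setBernoulli (Set.univ : Set ι) p {S | ∀ i ∈ u, i ∉ S} =
      (unitInterval.toNNReal (unitInterval.symm p) : ℝ≥0∞) ^ u.card := by
  classical
  rw [setBernoulli_apply']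
  have : ((fun p : ι → Prop => {i | p i}) ⁻¹' {S | ∀ i ∈ u, i ∉ S}) =
      Set.pi (u : Set ι) (fun _ => {False}) := by
    ext f
    simp [Set.mem_pi]
  rw [this, Measure.infinitePi_pi _ (fun _ _ => MeasurableSet.of_discrete)]
  simp [Finset.prod_const]

/-- The separation fails to grow only if all of the first `m` small pairs, whose far anyons are at
distance at most `3 * m ≤ (2 / 3) ^ (1 / α) * r`, are absent. -/
lemma le_bias {α : ℝ} (hα : 0 < α) {p : ℝ} (hp₀ : 0 < p) (hp₁ : p < 1) {r : ℕ} (hr : 0 < r) :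
    1 - 2 * (1 - p) ^ ⌊(2 : ℝ) ^ (1 / α) * (3 : ℝ) ^ (-(1 / α) - 1) * r⌋₊ ≤
      bias α ⟨p, hp₀.le, hp₁.le⟩ r := by
  classical
  set m := ⌊(2 : ℝ) ^ (1 / α) * (3 : ℝ) ^ (-(1 / α) - 1) * r⌋₊ with hm
  set μ := setBernoulli (Set.univ : Set ℕ+) ⟨p, hp₀.le, hp₁.le⟩ with hμ
  have hc : 3 * ((2 : ℝ) ^ (1 / α) * (3 : ℝ) ^ (-(1 / α) - 1) * r) = (2 / 3 : ℝ) ^ (1 / α) * r := by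
    rw [Real.rpow_sub_one (by norm_num), Real.rpow_neg (by norm_num),
      Real.div_rpow (by norm_num) (by norm_num)]
    field_simp
  let u : Finset ℕ+ := (Finset.range m).map ⟨Nat.succPNat, Nat.succPNat_injective⟩
  have hu : ∀ n ∈ u, (3 * (n : ℕ) : ℝ) ≤ (2 / 3 : ℝ) ^ (1 / α) * r := by
    intro n hn
    simp only [u, Finset.mem_map, Finset.mem_range, Function.Embedding.coeFn_mk] at hn
    obtain ⟨k, hk, rfl⟩ := hn
    rw [← hc]
    have h1 : (m : ℝ) ≤ _ := Nat.floor_le (a := (2 : ℝ) ^ (1 / α) * (3 : ℝ) ^ (-(1 / α) - 1) * r)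
      (by positivity)
    have h2 : ((k.succPNat : ℕ) : ℝ) ≤ m := by
      rw [Nat.succPNat_coe]; exact_mod_cast hk
    linarith
  set E : Set (Set ℕ+) := {S | ∀ i ∈ u, i ∉ S} with hE
  have hEm : MeasurableSet E := by
    have : E = ⋂ i ∈ u, {S : Set ℕ+ | i ∈ S}ᶜ := by ext S; simp [hE]
    rw [this]
    exact u.measurableSet_biInter fun i _ => (measurableSet_setOfPred.2
      (measurable_set_mem i)).compl
  have hEp : μ.real E = (1 - p) ^ m := by
    rw [measureReal_def, hμ, hE, setBernoulli_univ_disjoint, ENNReal.toReal_pow]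
    simp [u]
  have hpos : ∀ S ∈ Eᶜ, 0 < pairForce α r S r := by
    intro S hS
    simp only [hE, Set.mem_compl_iff, Set.mem_ofPred_eq, not_forall, not_not] at hS
    obtain ⟨n, hn, hnS⟩ := hS
    exact pairForce_right_pos hα hr hnS (hu n hn)
  have h1 : μ.real Eᶜ ≤ μ.real {S | nextSeparation α r S = r + 2} := by
    refine measureReal_mono fun S hS => ?_
    rw [Set.mem_ofPred_eq, nextSeparation_eq, sign_pos (hpos S hS)]
    rfl
  have h2 : μ.real {S | nextSeparation α r S = r - 2} ≤ μ.real E := by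
    refine measureReal_mono fun S hS => ?_
    by_contra hSE
    rw [Set.mem_ofPred_eq, nextSeparation_eq, sign_pos (hpos S hSE)] at hS
    simp at hS
    omega
  rw [measureReal_compl hEm, hEp, probReal_univ] at h1
  rw [hEp] at h2
  unfold bias
  linarith

/-! ### Bounded and local random sets -/

section Counting
variable {ι J : Type*} [Fintype J] {Sl : Type*} [Fintype Sl] [DecidableEq Sl]
  {W : Sl → ℕ}

/-- The random set produced by a base point `ω.1` and one choice `ω.2 s` for each slot `s`. -/
def slotSet (loc : J → (s : Sl) → Fin (W s) → ι) (ω : J × (∀ s, Fin (W s))) : Set ι :=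
  {z | ∃ s, loc ω.1 s (ω.2 s) = z}

open Classical in
/-- If the slots with fewer than `K` choices all belong to a set `E` of slots whose locations betray
the base point, and the number of base points makes up for the missing choices, then the set is
`1 / K`-bounded under the uniform distribution: a set `A` of locations either determines the base
point, or involves only slots with at least `K` choices. -/
lemma card_subset_slotSet_mul_le (loc : J → (s : Sl) → Fin (W s) → ι) (K : ℕ) (E : Finset Sl)
    (hinj : ∀ m s y s' y', loc m s y = loc m s' y' → (⟨s, y⟩ : Σ s, Fin (W s)) = ⟨s', y'⟩)
    (hE : ∀ m, ∀ s ∈ E, ∀ y m' s' y', loc m s y = loc m' s' y' → m = m')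
    (hWE : ∀ s ∈ E, W s ≤ K) (hW : ∀ s ∉ E, K ≤ W s)
    (hK : K ^ E.card ≤ Fintype.card J * ∏ s ∈ E, W s) (A : Finset ι) :
    (Finset.univ.filter fun ω => (A : Set ι) ⊆ slotSet loc ω).card * K ^ A.card ≤
      Fintype.card (J × (∀ s, Fin (W s))) := by
  -- the number of choices that are compatible with a given base point
  set c : J → ℕ := fun m => (Finset.univ.filter fun y : ∀ s, Fin (W s) =>
    (A : Set ι) ⊆ slotSet loc (m, y)).card with hc
  have hsum : (Finset.univ.filter fun ω => (A : Set ι) ⊆ slotSet loc ω).card = ∑ m, c m := by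
    simp only [hc, Finset.card_filter]
    exact Fintype.sum_prod_type _
  have hbound : ∀ m, ∃ S : Finset Sl, c m * K ^ A.card ≤ ∏ s, (if s ∈ S then K else W s) ∧
      (c m ≠ 0 → ∀ s ∈ S, ∃ y, loc m s y ∈ A) := by
    intro m
    rcases (Finset.univ.filter fun y : ∀ s, Fin (W s) =>
      (A : Set ι) ⊆ slotSet loc (m, y)).eq_empty_or_nonempty with h | ⟨y0, hy0⟩
    · have h0 : c m = 0 := by simp only [hc, h, Finset.card_empty]
      exact ⟨∅, by rw [h0]; simp, fun h => absurd h0 h⟩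
    · refine ⟨Finset.univ.filter fun s => loc m s (y0 s) ∈ A, ?_, fun _ s hs =>
        ⟨y0 s, by simpa using hs⟩⟩
      set S := Finset.univ.filter fun s => loc m s (y0 s) ∈ A with hS
      have hA : A.card = S.card := by
        refine (Finset.card_nbij (fun s => loc m s (y0 s)) ?_ ?_ ?_).symm
        · intro s hs; simpa [hS] using hs
        · intro s _ s' _ h
          exact congrArg Sigma.fst (hinj m s _ s' _ h)
        · intro a ha
          obtain ⟨s, hs⟩ := (Finset.mem_filter.1 hy0).2 ha
          exact ⟨s, by simp only [hS, Finset.coe_filter]; simpa [hs] using ha, hs⟩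
      have h1 : c m ≤ (Fintype.piFinset fun s : Sl =>
          if s ∈ S then {y0 s} else (Finset.univ : Finset (Fin (W s)))).card := by
        refine Finset.card_le_card fun y hy => ?_
        rw [Fintype.mem_piFinset]
        intro s
        split_ifs with hs
        · obtain ⟨s', hs'⟩ := (Finset.mem_filter.1 hy).2 (Finset.mem_filter.1 hs).2
          have := hinj m s' _ s _ hs'
          obtain rfl : s' = s := congrArg Sigma.fst this
          simpa using this
        · exact Finset.mem_univ _
      rw [Fintype.card_piFinset] at h1
      calc c m * K ^ A.card ≤ (∏ s, (if s ∈ S then 1 else W s)) * K ^ A.card := by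
            refine Nat.mul_le_mul_right _ (h1.trans (le_of_eq ?_))
            refine Finset.prod_congr rfl fun s _ => ?_
            split_ifs <;> simp
        _ = (∏ s, (if s ∈ S then 1 else W s)) * ∏ s, (if s ∈ S then K else 1) := by
            rw [hA, Finset.prod_ite_mem, Finset.univ_inter, Finset.prod_const]
        _ = ∏ s, (if s ∈ S then K else W s) := by
            rw [← Finset.prod_mul_distrib]
            refine Finset.prod_congr rfl fun s _ => ?_
            split_ifs <;> simp
  rw [hsum, Finset.sum_mul, Fintype.card_prod, Fintype.card_pi]
  simp only [Fintype.card_fin]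
  by_cases hearly : ∃ m, ∃ s ∈ E, ∃ y, loc m s y ∈ A
  · obtain ⟨m, s0, hs0, y0, ha⟩ := hearly
    rw [Finset.sum_eq_single m]
    · obtain ⟨S, h1, -⟩ := hbound m
      calc c m * K ^ A.card ≤ ∏ s, (if s ∈ S then K else W s) := h1
        _ ≤ ∏ s, ((if s ∈ E then K else 1) * (if s ∈ E then 1 else W s)) := by
            refine Finset.prod_le_prod' fun s _ => ?_
            by_cases h : s ∈ E
            · simp only [h, if_true, mul_one]
              split_ifs
              exacts [le_rfl, hWE s h]
            · simp only [h, if_false, one_mul]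
              split_ifs
              exacts [hW s h, le_rfl]
        _ = K ^ E.card * ∏ s, (if s ∈ E then 1 else W s) := by
            rw [Finset.prod_mul_distrib, Finset.prod_ite_mem, Finset.univ_inter,
              Finset.prod_const]
        _ ≤ (Fintype.card J * ∏ s ∈ E, W s) * ∏ s, (if s ∈ E then 1 else W s) :=
            Nat.mul_le_mul_right _ hK
        _ = Fintype.card J * ∏ s, W s := by
            rw [mul_assoc]
            congr 1
            rw [← Finset.univ_inter E, ← Finset.prod_ite_mem, ← Finset.prod_mul_distrib]
            refine Finset.prod_congr rfl fun s _ => ?_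
            by_cases h : s ∈ E <;> simp [h]
    · intro m' _ hm'
      have : c m' = 0 := by
        rw [hc, Finset.card_eq_zero, Finset.filter_eq_empty_iff]
        intro y _ hy
        obtain ⟨s, hs⟩ := hy ha
        exact hm' (hE m s0 hs0 y0 m' s (y s) hs.symm).symm
      rw [this, zero_mul]
    · simp
  · push Not at hearly
    calc ∑ m, c m * K ^ A.card ≤ ∑ m : J, ∏ s, W s := by
          refine Finset.sum_le_sum fun m _ => ?_
          obtain ⟨S, h1, h2⟩ := hbound m
          by_cases h0 : c m = 0
          · rw [h0, zero_mul]; exact Nat.zero_le _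
          refine h1.trans (Finset.prod_le_prod' fun s _ => ?_)
          split_ifs with hs
          · obtain ⟨y, hy⟩ := h2 h0 s hs
            exact hW s fun hsE => hearly m s hsE y hy
          · exact le_rfl
      _ = Fintype.card J * ∏ s, W s := by simp

end Counting

section Product
variable {ι I Ω₀ : Type*} [Fintype I] [Fintype Ω₀] [MeasurableSpace Ω₀]
  [MeasurableSingletonClass Ω₀]

/-- The union of independent random sets, one for each block `i`, each of them a function of a
uniformly distributed element of `Ω₀`. -/
noncomputable def blockMeasure (S : I → Ω₀ → Set ι) : Measure (Set ι) :=
  (Measure.pi fun _ : I => (uniformOn Set.univ : Measure Ω₀)).map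
    fun ω => {z | ∃ i, z ∈ S i (ω i)}

instance [Nonempty Ω₀] : IsProbabilityMeasure (uniformOn Set.univ : Measure Ω₀) :=
  isProbabilityMeasure_uniformOn Set.finite_univ Set.univ_nonempty

instance [Nonempty Ω₀] (S : I → Ω₀ → Set ι) : IsProbabilityMeasure (blockMeasure S) :=
  Measure.isProbabilityMeasure_map (measurable_of_countable _).aemeasurable

lemma measurableSet_setOf_finset_subset (A : Finset ι) :
    MeasurableSet {N : Set ι | (A : Set ι) ⊆ N} := by
  have : {N : Set ι | (A : Set ι) ⊆ N} = ⋂ a ∈ A, {N : Set ι | a ∈ N} := by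
    ext N; simp [Set.subset_def]
  rw [this]
  exact A.measurableSet_biInter fun a _ => measurableSet_setOfPred.2 (measurable_set_mem a)

open Classical in
/-- A union of independent `1 / K`-bounded sets in disjoint regions `{z | Z z = i}` is
`p`-bounded for all `p > 1 / K`. -/
lemma pBounded_blockMeasure (S : I → Ω₀ → Set ι) (Z : ι → I) (hZ : ∀ i ω, ∀ z ∈ S i ω, Z z = i)
    {K : ℕ} (hK0 : 0 < K) {p : ℝ} (hp : 1 / (K : ℝ) < p)
    (hS : ∀ i (A : Finset ι), (Finset.univ.filter fun ω => (A : Set ι) ⊆ S i ω).card * K ^ A.card ≤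
      Fintype.card Ω₀) :
    PBounded p (blockMeasure S) := by
  intro A hA
  have hK : (K : ℝ≥0∞) ≠ 0 := by exact_mod_cast hK0.ne'
  have hKinv : ((K : ℝ≥0∞)⁻¹) ^ A.card < ENNReal.ofReal p ^ A.card := by
    refine ENNReal.pow_lt_pow_left hA.card_pos.ne' ?_
    rw [← ENNReal.ofReal_natCast, ← ENNReal.ofReal_inv_of_pos (by exact_mod_cast hK0)]
    refine (ENNReal.ofReal_lt_ofReal_iff ?_).2 (by simpa using hp)
    exact lt_trans (by positivity) hp
  refine lt_of_le_of_lt ?_ hKinv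
  rw [blockMeasure, Measure.map_apply (measurable_of_countable _)
    (measurableSet_setOf_finset_subset A)]
  have hsub : (fun ω : I → Ω₀ => {z | ∃ i, z ∈ S i (ω i)}) ⁻¹' {N | (A : Set ι) ⊆ N} ⊆
      Set.pi Set.univ fun i => {ω | ((A.filter fun z => Z z = i : Finset ι) : Set ι) ⊆ S i ω} := by
    intro ω hω i _ z hz
    simp only [Finset.coe_filter, Set.mem_ofPred_eq] at hz
    obtain ⟨j, hj⟩ := hω (Finset.mem_coe.2 hz.1)
    obtain rfl : j = i := (hZ j _ z hj).symm.trans hz.2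
    exact hj
  refine (measure_mono hsub).trans ?_
  rw [Measure.pi_pi]
  have hcard : A.card = ∑ i, (A.filter fun z => Z z = i).card :=
    Finset.card_eq_sum_card_fiberwise fun _ _ => Finset.mem_coe.2 (Finset.mem_univ _)
  rw [hcard, ← Finset.prod_pow_eq_pow_sum]
  refine Finset.prod_le_prod' fun i _ => ?_
  set B := A.filter fun z => Z z = i
  have : {ω | (B : Set ι) ⊆ S i ω} =
      ((Finset.univ.filter fun ω => (B : Set ι) ⊆ S i ω : Finset Ω₀) : Set Ω₀) := by
    ext; simp
  rw [this, uniformOn_univ, Measure.count_apply_finset, ← ENNReal.inv_pow]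
  refine ENNReal.div_le_of_le_mul ?_
  rw [mul_comm, ← div_eq_mul_inv]
  rw [ENNReal.le_div_iff_mul_le (Or.inl (pow_ne_zero _ hK))
    (Or.inl (ENNReal.pow_ne_top (ENNReal.natCast_ne_top K)))]
  exact_mod_cast hS i B

/-- The restrictions of `blockMeasure S` to two sets that do not meet the same block are
independent. -/
lemma indepFun_blockMeasure [Nonempty Ω₀] (S : I → Ω₀ → Set ι) (A B : Set ι)
    (h : ∀ i ω ω' z z', z ∈ S i ω → z ∈ A → z' ∈ S i ω' → z' ∈ B → False) :
    IndepFun (fun N : Set ι => {z ∈ N | z ∈ A}) (fun N : Set ι => {z ∈ N | z ∈ B})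
      (blockMeasure S) := by
  classical
  set ν := Measure.pi fun _ : I => (uniformOn Set.univ : Measure Ω₀) with hν
  have hmeas : ∀ C : Set ι, Measurable fun N : Set ι => {z ∈ N | z ∈ C} := by
    intro C
    refine measurable_set_iff.2 fun z => ?_
    by_cases hz : z ∈ C
    · simpa [hz] using measurable_set_mem z
    · simp [hz]
  have hcoord : iIndepFun (fun (i : I) (ω : I → Ω₀) => ω i) ν :=
    iIndepFun_pi (X := fun _ => id) fun _ => aemeasurable_id
  let touch : Set ι → Finset I := fun C => Finset.univ.filter fun i => ∃ ω, ∃ z ∈ S i ω, z ∈ C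
  have hdisj : Disjoint (touch A) (touch B) := by
    rw [Finset.disjoint_left]
    intro i hi hi'
    obtain ⟨ω, z, hz, hzA⟩ := (Finset.mem_filter.1 hi).2
    obtain ⟨ω', z', hz', hzB⟩ := (Finset.mem_filter.1 hi').2
    exact h i ω ω' z z' hz hzA hz' hzB
  have hind := hcoord.indepFun_finset (touch A) (touch B) hdisj fun i => measurable_pi_apply i
  let g : (C : Set ι) → (touch C → Ω₀) → Set ι := fun C y => {z | (∃ i, z ∈ S i.1 (y i)) ∧ z ∈ C}
  have hg : ∀ (C : Set ι) (ω : I → Ω₀), {z ∈ {z | ∃ i, z ∈ S i (ω i)} | z ∈ C} =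
      g C fun i => ω i := by
    intro C ω
    ext z
    constructor
    · rintro ⟨⟨i, hi⟩, hC⟩
      exact ⟨⟨⟨i, Finset.mem_filter.2 ⟨Finset.mem_univ _, _, z, hi, hC⟩⟩, hi⟩, hC⟩
    · rintro ⟨⟨i, hi⟩, hC⟩
      exact ⟨⟨i, hi⟩, hC⟩
  have hind2 := hind.comp (φ := g A) (ψ := g B) (measurable_of_countable _)
    (measurable_of_countable _)
  rw [indepFun_iff_measure_inter_preimage_eq_mul] at hind2 ⊢
  intro s t hs ht
  have hm : Measurable fun ω : I → Ω₀ => {z | ∃ i, z ∈ S i (ω i)} := measurable_of_countable _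
  have := hind2 s t hs ht
  rw [blockMeasure, Measure.map_apply hm (((hmeas A) hs).inter ((hmeas B) ht)),
    Measure.map_apply hm ((hmeas A) hs), Measure.map_apply hm ((hmeas B) ht)]
  have hpre : ∀ (C : Set ι) (s : Set (Set ι)),
      (fun ω : I → Ω₀ => {z | ∃ i, z ∈ S i (ω i)}) ⁻¹' ((fun N : Set ι => {z ∈ N | z ∈ C}) ⁻¹' s) =
        (g C ∘ fun (ω : I → Ω₀) (i : touch C) => ω i) ⁻¹' s := fun C s =>
    congrArg (· ⁻¹' s) (funext (hg C))
  rw [Set.preimage_inter, hpre, hpre]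
  exact this

/-- A property that holds for all outcomes holds almost surely; `ι` is countable, so that single
sets are measurable. -/
lemma blockMeasure_eq_zero [Countable ι] (S : I → Ω₀ → Set ι) (E : Set (Set ι))
    (hE : ∀ ω : I → Ω₀, {z | ∃ i, z ∈ S i (ω i)} ∉ E) : blockMeasure S E = 0 := by
  have hm : Measurable fun ω : I → Ω₀ => {z | ∃ i, z ∈ S i (ω i)} := measurable_of_countable _
  have hr : (Set.range fun ω : I → Ω₀ => {z | ∃ i, z ∈ S i (ω i)}).Finite := Set.finite_range _
  have : MeasurableSingletonClass (Set ι) :=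
    inferInstanceAs (MeasurableSingletonClass (ι → Prop))
  refine measure_mono_null (t := (Set.range fun ω : I → Ω₀ => {z | ∃ i, z ∈ S i (ω i)})ᶜ) ?_ ?_
  · rintro N hN ⟨ω, rfl⟩
    exact hE ω hN
  · rw [blockMeasure, Measure.map_apply hm hr.measurableSet.compl]
    convert measure_empty (μ := Measure.pi fun _ : I => (uniformOn Set.univ : Measure Ω₀))
    ext ω
    simp

end Product

/-! ### Forces on a ring of blocks -/

/-- The one-dimensional power-law force of an anyon at displacement `z` on the ring `ZMod L`. -/
noncomputable def ringForce {L : ℕ} (α : ℝ) (z : ZMod L) : ℝ :=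
  (|(z.valMinAbs : ℝ)| ^ (α + 1))⁻¹ * z.valMinAbs

/-- The force on the ring as a function of the displacement in the positive direction, which runs
from `0` to `L`. -/
noncomputable def arcForce (α L x : ℝ) : ℝ := if 2 * x ≤ L then x ^ (-α) else -(L - x) ^ (-α)

lemma ringForce_of_pos {L : ℕ} [NeZero L] (α : ℝ) {D : ℤ} (h0 : 0 < D) (h : 2 * D ≤ L) :
    ringForce α (D : ZMod L) = (D : ℝ) ^ (-α) := by
  have hv : (D : ZMod L).valMinAbs = D :=
    (ZMod.valMinAbs_spec _ _).2 ⟨rfl, by constructor <;> omega⟩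
  have h0' : (0 : ℝ) < D := by exact_mod_cast h0
  rw [ringForce, hv, abs_of_pos h0', ← Real.rpow_neg h0'.le, neg_add, Real.rpow_add h0',
    Real.rpow_neg_one, mul_assoc, inv_mul_cancel₀ h0'.ne', mul_one]

lemma ringForce_of_neg {L : ℕ} [NeZero L] (α : ℝ) {D : ℤ} (h0 : D < 0) (h : -(L : ℤ) < 2 * D) :
    ringForce α (D : ZMod L) = -(-D : ℝ) ^ (-α) := by
  have hv : (D : ZMod L).valMinAbs = D :=
    (ZMod.valMinAbs_spec _ _).2 ⟨rfl, by constructor <;> omega⟩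
  have h0' : (0 : ℝ) < -D := by exact_mod_cast neg_pos.2 h0
  rw [ringForce, hv, abs_of_neg (by linarith), ← Real.rpow_neg h0'.le, neg_add,
    Real.rpow_add h0', Real.rpow_neg_one]
  have hD : (D : ℝ) ≠ 0 := by exact_mod_cast h0.ne
  field_simp

lemma ringForce_zero {L : ℕ} (α : ℝ) : ringForce α (0 : ZMod L) = 0 := by
  simp [ringForce]

lemma ringForce_eq_arcForce {L : ℕ} [NeZero L] (α : ℝ) {D : ℤ} (h0 : 0 < D) (h : D < L) :
    ringForce α (D : ZMod L) = arcForce α L D := by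
  rw [arcForce]
  split_ifs with h2
  · exact ringForce_of_pos α h0 (by exact_mod_cast h2)
  · have h2' : (L : ℤ) < 2 * D := by exact_mod_cast not_le.1 h2
    have : (D : ZMod L) = ((D - L : ℤ) : ZMod L) := by push_cast; simp
    rw [this, ringForce_of_neg α (by omega) (by omega)]
    push_cast
    ring_nf

lemma arcForce_anti {α L : ℝ} (hα : 0 < α) {x y : ℝ} (hx : 0 < x) (hxy : x ≤ y) (hy : y < L) :
    arcForce α L y ≤ arcForce α L x := by
  unfold arcForce
  split_ifs with h1 h2 h2
  · exact rpow_neg_antitone hα hx hxy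
  · linarith
  · have := Real.rpow_nonneg (sub_pos.2 hy).le (-α)
    have := Real.rpow_nonneg hx.le (-α)
    linarith
  · exact neg_le_neg (rpow_neg_antitone hα (by linarith) (by linarith))

lemma arcForce_add_reflect {α L : ℝ} (x : ℝ) :
    arcForce α L x + arcForce α L (L - x) = if 2 * x = L then 2 * (L / 2) ^ (-α) else 0 := by
  unfold arcForce
  rcases lt_trichotomy (2 * x) L with h | h | h
  · rw [if_pos h.le, if_neg (by linarith), if_neg h.ne]; ring_nf
  · rw [if_pos h.le, if_pos (by linarith), if_pos h]
    have : x = L / 2 := by linarith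
    rw [this]; ring_nf
  · rw [if_neg (by linarith), if_pos (by linarith), if_neg h.ne']; ring_nf

/-- The forces of equally spaced anyons on the ring cancel, up to that of an antipodal anyon. -/
lemma sum_arcForce_grid {α L : ℝ} (hL : 0 < L) {n : ℕ} (hn : 0 < n) :
    0 ≤ ∑ k ∈ Finset.Ico 1 n, arcForce α L (k * (L / n)) ∧
      ∑ k ∈ Finset.Ico 1 n, arcForce α L (k * (L / n)) ≤ (L / 2) ^ (-α) := by
  have hn' : (0 : ℝ) < n := by exact_mod_cast hn
  have hpos : 0 ≤ (L / 2) ^ (-α) := by positivity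
  have hrefl : ∑ k ∈ Finset.Ico 1 n, arcForce α L (k * (L / n)) =
      ∑ k ∈ Finset.Ico 1 n, arcForce α L (L - k * (L / n)) := by
    refine Finset.sum_nbij' (fun k => n - k) (fun k => n - k) ?_ ?_ ?_ ?_ ?_
    all_goals
      intro k hk
      rw [Finset.mem_Ico] at hk
    · rw [Finset.mem_Ico]; omega
    · rw [Finset.mem_Ico]; omega
    · omega
    · omega
    · rw [Nat.cast_sub hk.2.le]
      congr 1
      field_simp
      ring
  have h2 : 2 * ∑ k ∈ Finset.Ico 1 n, arcForce α L (k * (L / n)) =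
      ∑ k ∈ Finset.Ico 1 n, if 2 * k = n then 2 * (L / 2) ^ (-α) else 0 := by
    rw [two_mul]
    nth_rewrite 2 [hrefl]
    rw [← Finset.sum_add_distrib]
    refine Finset.sum_congr rfl fun k _ => ?_
    rw [arcForce_add_reflect]
    congr 1
    rw [← @Nat.cast_inj ℝ, eq_iff_iff]
    push_cast
    constructor <;> intro h
    · field_simp at h; linarith
    · field_simp; linarith
  rw [← Finset.sum_filter, Finset.sum_const, nsmul_eq_mul] at h2
  have hcard : (((Finset.Ico 1 n).filter fun k => 2 * k = n).card : ℝ) ≤ 1 := by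
    norm_cast
    refine Finset.card_le_one.2 fun a ha b hb => ?_
    rw [Finset.mem_filter] at ha hb
    omega
  constructor
  · have : (0 : ℝ) ≤ 2 * ∑ k ∈ Finset.Ico 1 n, arcForce α L (k * (L / n)) := by
      rw [h2]; positivity
    linarith
  · nlinarith

/-- The forces of one anyon in each distant block nearly cancel, even if there are arbitrarily many
blocks and if `∑ 1 / k ^ α` diverges: they are compared with those of an equally spaced array. -/
lemma abs_sum_arcForce_le {α L : ℝ} (hα : 0 < α) (hL : 0 < L) {n : ℕ} (hn : 10 ≤ n) (D : ℕ → ℝ)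
    (hD : ∀ k ∈ Finset.Ico 3 (n - 2), ((k : ℝ) - 2) * (L / n) ≤ D k ∧
      D k ≤ ((k : ℝ) + 2) * (L / n)) :
    |∑ k ∈ Finset.Ico 3 (n - 2), arcForce α L (D k)| ≤ 5 * (L / n) ^ (-α) := by
  obtain ⟨hS0, hS1⟩ := sum_arcForce_grid (α := α) hL (n := n) (by omega)
  have hn' : (10 : ℝ) ≤ n := by exact_mod_cast hn
  set lam := L / n with hlam
  have hlam0 : 0 < lam := by positivity
  have hLn : n * lam = L := by rw [hlam]; field_simp
  have hgrid : ∀ k ∈ Finset.Ico 1 5, arcForce α L ((k : ℕ) * lam) ≤ lam ^ (-α) := by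
    intro k hk
    rw [Finset.mem_Ico] at hk
    have h1 : (1 : ℝ) ≤ k := by exact_mod_cast hk.1
    have h5 : (k : ℝ) ≤ 4 := by exact_mod_cast Nat.lt_succ_iff.1 hk.2
    rw [arcForce, if_pos (by nlinarith)]
    exact rpow_neg_antitone hα hlam0 (by nlinarith)
  have hgrid' : ∀ k ∈ Finset.Ico (n - 4) n, -lam ^ (-α) ≤ arcForce α L ((k : ℕ) * lam) := by
    intro k hk
    rw [Finset.mem_Ico] at hk
    have h1 : (k : ℝ) + 1 ≤ n := by exact_mod_cast hk.2
    have h5 : (n : ℝ) ≤ k + 4 := by exact_mod_cast (by omega : n ≤ k + 4)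
    rw [arcForce, if_neg (by nlinarith)]
    exact neg_le_neg (rpow_neg_antitone hα hlam0 (by nlinarith))
  have hhalf : (L / 2) ^ (-α) ≤ lam ^ (-α) := rpow_neg_antitone hα hlam0 (by nlinarith)
  rw [abs_le]
  constructor
  · have h1 : ∑ k ∈ Finset.Ico 5 n, arcForce α L ((k : ℕ) * lam) ≤
        ∑ k ∈ Finset.Ico 3 (n - 2), arcForce α L (D k) := by
      have : Finset.Ico 5 n = Finset.Ico (3 + 2) (n - 2 + 2) := by congr 1; omega
      rw [this, ← Finset.sum_Ico_add']
      refine Finset.sum_le_sum fun k hk => ?_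
      obtain ⟨h1, h2⟩ := hD k hk
      rw [Finset.mem_Ico] at hk
      have h3 : (3 : ℝ) ≤ k := by exact_mod_cast hk.1
      have h4 : (k : ℝ) + 3 ≤ n := by exact_mod_cast (by omega : k + 3 ≤ n)
      push_cast
      exact arcForce_anti hα (by nlinarith) h2 (by nlinarith)
    have h2 := Finset.sum_Ico_consecutive (fun k : ℕ => arcForce α L (k * lam)) (m := 1) (n := 5)
      (k := n) (by omega) (by omega)
    have h3 := Finset.sum_le_sum hgrid
    simp only [Finset.sum_const, Nat.card_Ico, nsmul_eq_mul] at h3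
    have h4 : 0 ≤ lam ^ (-α) := by positivity
    push_cast at h3
    linarith
  · have h1 : ∑ k ∈ Finset.Ico 3 (n - 2), arcForce α L (D k) ≤
        ∑ k ∈ Finset.Ico 1 (n - 4), arcForce α L ((k : ℕ) * lam) := by
      have : Finset.Ico 3 (n - 2) = Finset.Ico (1 + 2) (n - 4 + 2) := by congr 1; omega
      rw [this, ← Finset.sum_Ico_add']
      refine Finset.sum_le_sum fun k hk => ?_
      rw [Finset.mem_Ico] at hk
      obtain ⟨h1, h2⟩ := hD (k + 2) (by rw [Finset.mem_Ico]; omega)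
      have h3 : (1 : ℝ) ≤ k := by exact_mod_cast hk.1
      have h4 : (k : ℝ) + 5 ≤ n := by exact_mod_cast (by omega : k + 5 ≤ n)
      push_cast at h1 h2
      exact arcForce_anti hα (by nlinarith) (by linarith) (by nlinarith)
    have h2 := Finset.sum_Ico_consecutive (fun k : ℕ => arcForce α L (k * lam)) (m := 1)
      (n := n - 4) (k := n) (by omega) (by omega)
    have h3 := Finset.sum_le_sum hgrid'
    have h5 : n - (n - 4) = 4 := by omega
    simp only [Finset.sum_const, Nat.card_Ico, nsmul_eq_mul, h5] at h3
    push_cast at h3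
    linarith

/-- A periodic function has the same sum over all windows of one period. -/
lemma sum_Ico_of_periodic {n : ℕ} (h : ℤ → ℝ) (hper : ∀ i, h (i + n) = h i) (a : ℤ) :
    ∑ i ∈ Finset.Ico a (a + n), h i = ∑ i ∈ Finset.Ico (0 : ℤ) n, h i := by
  have step : ∀ b : ℤ, ∑ i ∈ Finset.Ico (b + 1) (b + 1 + n), h i =
      ∑ i ∈ Finset.Ico b (b + n), h i := by
    intro b
    rcases Nat.eq_zero_or_pos n with rfl | hn
    · simp
    have h1 : Finset.Ico b (b + n) = insert b (Finset.Ico (b + 1) (b + n)) := by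
      ext; simp only [Finset.mem_insert, Finset.mem_Ico]; omega
    have h2 : Finset.Ico (b + 1) (b + 1 + n) = insert (b + n) (Finset.Ico (b + 1) (b + n)) := by
      ext; simp only [Finset.mem_insert, Finset.mem_Ico]; omega
    rw [h1, h2, Finset.sum_insert (by simp), Finset.sum_insert (by simp), hper]
  induction a using Int.induction_on with
  | zero => simp
  | succ b ih => rw [step, ih]
  | pred b ih => rw [← ih, ← step, sub_add_cancel]

/-- **Dominance.** An anyon at `x` in block `j` moves towards an anyon at distance `D` on its side
`s` if all others are on the same side or at a much larger distance `E`, provided that every block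
contains the same number of anyons. For each `q`, the anyons `pos i q` pull to the wrong side with
at most `10 * E ^ (-α)`: one unit from the own block, four from the blocks `j ± 1` and `j ± 2`, and
five from all others. -/
lemma mul_sum_ringForce_pos {κ : Type*} [Fintype κ] {α : ℝ} (hα : 0 < α) {L n : ℕ} [NeZero L]
    (hn : 10 ≤ n) (pos : ℤ → κ → ℤ) (hper : ∀ i q, pos (i + n) q = pos i q + L) (x j : ℤ) {D E : ℤ}
    (hD : 0 < D) (hE : 0 < E) {s : ℤ} (hs : s = 1 ∨ s = -1) (q₀ : κ)
    (h1 : ∀ (k : ℤ) q, |(pos (j + k) q : ℝ) - x - k * ((L : ℝ) / n)| ≤ 2 * ((L : ℝ) / n))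
    (h2 : ∀ k : ℤ, k ≠ 0 → |k| ≤ 2 → ∀ q, E ≤ |pos (j + k) q - x|)
    (h3 : s * (pos j q₀ - x) = D)
    (h4 : ∀ q, 0 ≤ s * (pos j q - x) ∨ E ≤ |pos j q - x|)
    (h5 : (E : ℝ) ≤ (L : ℝ) / n)
    (h6 : 10 * Fintype.card κ * (E : ℝ) ^ (-α) < (D : ℝ) ^ (-α)) :
    0 < s * ∑ i ∈ Finset.Ico (0 : ℤ) n, ∑ q, ringForce α ((pos i q - x : ℤ) : ZMod L) := by
  classical
  have hL : (0 : ℝ) < L := by exact_mod_cast NeZero.pos L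
  have hn' : (10 : ℝ) ≤ n := by exact_mod_cast hn
  set lam := (L : ℝ) / n with hlam
  have hlam0 : 0 < lam := by positivity
  have hLn : n * lam = L := by rw [hlam]; field_simp
  have hE' : (0 : ℝ) < E := by exact_mod_cast hE
  have hs1 : |(s : ℝ)| = 1 := by rcases hs with rfl | rfl <;> simp
  -- displacements to anyons in the blocks `j - 2, …, j + 2` are less than half a turn
  have hnear : ∀ k : ℤ, |k| ≤ 2 → ∀ q, -(L : ℤ) < 2 * (pos (j + k) q - x) ∧
      2 * (pos (j + k) q - x) < L := by
    intro k hk q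
    have hk' := abs_le.1 hk
    have a1 : (-2 : ℝ) ≤ k := by exact_mod_cast hk'.1
    have a2 : (k : ℝ) ≤ 2 := by exact_mod_cast hk'.2
    have := abs_le.1 (h1 k q)
    have e1 : -(L : ℝ) < 2 * ((pos (j + k) q : ℝ) - x) := by nlinarith
    have e2 : 2 * ((pos (j + k) q : ℝ) - x) < L := by nlinarith
    exact ⟨by exact_mod_cast e1, by exact_mod_cast e2⟩
  have hfar : ∀ d : ℤ, -(L : ℤ) < 2 * d → 2 * d < L → E ≤ |d| →
      |ringForce α (d : ZMod L)| ≤ (E : ℝ) ^ (-α) := by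
    intro d d1 d2 hd
    rcases lt_trichotomy d 0 with h | h | h
    · rw [abs_of_neg h] at hd
      have hd' : (E : ℝ) ≤ -d := by exact_mod_cast hd
      rw [ringForce_of_neg α h d1, abs_neg, abs_of_nonneg (Real.rpow_nonneg (by linarith) _)]
      exact rpow_neg_antitone hα hE' hd'
    · rw [h, abs_zero] at hd; omega
    · rw [abs_of_pos h] at hd
      have hd' : (E : ℝ) ≤ d := by exact_mod_cast hd
      rw [ringForce_of_pos α h d2.le, abs_of_nonneg (Real.rpow_nonneg (by linarith) _)]
      exact rpow_neg_antitone hα hE' hd'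
  have hside : ∀ d : ℤ, -(L : ℤ) < 2 * d → 2 * d < L → 0 ≤ s * d →
      0 ≤ s * ringForce α (d : ZMod L) ∧ (s * d = D → s * ringForce α (d : ZMod L) =
        (D : ℝ) ^ (-α)) := by
    intro d d1 d2 hd
    rcases lt_trichotomy d 0 with h | h | h
    · obtain rfl : s = -1 := by rcases hs with rfl | rfl <;> omega
      have h' : (0 : ℝ) ≤ -d := by exact_mod_cast (by omega : 0 ≤ -d)
      rw [ringForce_of_neg α h d1]
      refine ⟨by push_cast; linarith [Real.rpow_nonneg h' (-α)], fun hdD => ?_⟩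
      have : (D : ℝ) = -d := by exact_mod_cast (by omega : D = -d)
      rw [this]; push_cast; ring
    · subst h
      rw [Int.cast_zero, ringForce_zero, mul_zero]
      exact ⟨le_rfl, fun h => by omega⟩
    · obtain rfl : s = 1 := by rcases hs with rfl | rfl <;> omega
      have h' : (0 : ℝ) ≤ d := by exact_mod_cast h.le
      rw [ringForce_of_pos α h d2.le]
      refine ⟨by push_cast; linarith [Real.rpow_nonneg h' (-α)], fun hdD => ?_⟩
      have : (D : ℝ) = d := by exact_mod_cast (by omega : D = d)
      rw [this]; push_cast; ring
  have hle : ∀ r : ℝ, -|r| ≤ s * r := by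
    intro r
    have := neg_abs_le (s * r)
    rwa [abs_mul, hs1, one_mul] at this
  -- the contribution of each of the anyon types
  have hq : ∀ q, (if q = q₀ then (D : ℝ) ^ (-α) else 0) - 10 * (E : ℝ) ^ (-α) ≤
      s * ∑ i ∈ Finset.Ico (0 : ℤ) n, ringForce α ((pos i q - x : ℤ) : ZMod L) := by
    intro q
    rw [← sum_Ico_of_periodic (fun i => ringForce α ((pos i q - x : ℤ) : ZMod L))
      (fun i => by rw [hper]; push_cast; simp) (j - 2)]
    have hsplit : Finset.Ico (j - 2) (j - 2 + n) = ({j} ∪ {j - 2, j - 1, j + 1, j + 2}) ∪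
        (Finset.Ico 3 (n - 2)).image (fun k : ℕ => j + k) := by
      ext i
      simp only [Finset.mem_union, Finset.mem_image, Finset.mem_insert, Finset.mem_singleton,
        Finset.mem_Ico]
      constructor
      · intro h
        by_cases hi : i ≤ j + 2
        · left; omega
        · right; exact ⟨(i - j).toNat, by omega, by omega⟩
      · rintro (h | ⟨k, h, rfl⟩) <;> omega
    rw [hsplit, Finset.sum_union, Finset.sum_union, Finset.sum_image, mul_add, mul_add,
      Finset.sum_singleton]
    · have hfarsum : -(5 * (E : ℝ) ^ (-α)) ≤ s * ∑ k ∈ Finset.Ico 3 (n - 2),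
          ringForce α ((pos (j + (k : ℕ)) q - x : ℤ) : ZMod L) := by
        refine le_trans (neg_le_neg ?_) (hle _)
        have e : ∀ k ∈ Finset.Ico 3 (n - 2),
            ringForce α ((pos (j + (k : ℕ)) q - x : ℤ) : ZMod L) =
              arcForce α L ((pos (j + (k : ℕ)) q : ℝ) - x) := by
          intro k hk
          rw [Finset.mem_Ico] at hk
          have a3 : (3 : ℝ) ≤ k := by exact_mod_cast hk.1
          have a4 : (k : ℝ) + 3 ≤ n := by exact_mod_cast (by omega : k + 3 ≤ n)
          have := abs_le.1 (h1 k q)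
          push_cast at this
          have e1 : (0 : ℝ) < (pos (j + k) q : ℝ) - x := by nlinarith
          have e2 : (pos (j + k) q : ℝ) - x < L := by nlinarith
          rw [ringForce_eq_arcForce α (by exact_mod_cast e1) (by exact_mod_cast e2)]
          push_cast; rfl
        rw [Finset.sum_congr rfl e]
        refine (abs_sum_arcForce_le hα hL hn _ fun k hk => ?_).trans ?_
        · have := abs_le.1 (h1 k q)
          push_cast at this
          constructor <;> linarith
        · have := rpow_neg_antitone hα hE' h5
          linarith
      have hnearsum : -(4 * (E : ℝ) ^ (-α)) ≤ s * ∑ i ∈ ({j - 2, j - 1, j + 1, j + 2} : Finset ℤ),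
          ringForce α ((pos i q - x : ℤ) : ZMod L) := by
        refine le_trans (neg_le_neg ?_) (hle _)
        refine (Finset.abs_sum_le_sum_abs _ _).trans ?_
        have hb : ∀ i ∈ ({j - 2, j - 1, j + 1, j + 2} : Finset ℤ),
            |ringForce α ((pos i q - x : ℤ) : ZMod L)| ≤ (E : ℝ) ^ (-α) := by
          intro i hi
          simp only [Finset.mem_insert, Finset.mem_singleton] at hi
          have hk : |i - j| ≤ 2 := abs_le.2 (by omega)
          have := hnear (i - j) hk q
          have h2' := h2 (i - j) (by omega) hk q
          rw [add_sub_cancel] at this h2'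
          exact hfar _ this.1 this.2 h2'
        refine (Finset.sum_le_sum hb).trans ?_
        rw [Finset.sum_const, nsmul_eq_mul]
        refine mul_le_mul_of_nonneg_right ?_ (by positivity)
        exact_mod_cast Finset.card_le_four
      have hown : (if q = q₀ then (D : ℝ) ^ (-α) else 0) - (E : ℝ) ^ (-α) ≤
          s * ringForce α ((pos j q - x : ℤ) : ZMod L) := by
        have hn0 := hnear 0 (by simp) q
        rw [add_zero] at hn0
        have hEp : 0 ≤ (E : ℝ) ^ (-α) := by positivity
        split_ifs with hqq
        · subst hqq
          rw [(hside _ hn0.1 hn0.2 (by omega)).2 h3]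
          linarith
        · rcases h4 q with h | h
          · have := (hside _ hn0.1 hn0.2 h).1
            linarith
          · have := (hle (ringForce α ((pos j q - x : ℤ) : ZMod L)))
            have := hfar _ hn0.1 hn0.2 h
            linarith
      linarith
    · intro a _ b _ hab
      simpa using hab
    · rw [Finset.disjoint_left]
      intro i hi
      simp only [Finset.mem_insert, Finset.mem_singleton] at hi ⊢
      omega
    · rw [Finset.disjoint_left]
      intro i hi
      simp only [Finset.mem_union, Finset.mem_insert, Finset.mem_singleton] at hi
      simp only [Finset.mem_image, Finset.mem_Ico, not_exists, not_and]
      intro k hk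
      omega
  rw [Finset.sum_comm, Finset.mul_sum]
  refine lt_of_lt_of_le ?_ (Finset.sum_le_sum fun q _ => hq q)
  rw [Finset.sum_sub_distrib, Finset.sum_ite_eq' Finset.univ q₀, Finset.sum_const,
    if_pos (Finset.mem_univ _), nsmul_eq_mul, Finset.card_univ]
  linarith

/-! ### Errors on a single lattice line -/

section Line
variable {d L : ℕ} (i₀ : Fin d)

/-- The site at coordinate `z` of the lattice line through the origin in direction `i₀`. -/
def lineSite (z : ZMod L) : Site d L := Pi.single i₀ z

/-- The edge from `z` to `z + 1` of the lattice line through the origin in direction `i₀`. -/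
def lineEdge (z : ZMod L) : Edge d L := (lineSite i₀ z, i₀)

open Classical in
/-- The chain on a lattice line that takes the value `X z` at the edge from `z` to `z + 1`. -/
noncomputable def lineChain (X : ZMod L → ZMod 2) : Chain d L :=
  fun e => if e = lineEdge i₀ (e.1 i₀) then X (e.1 i₀) else 0

lemma lineSite_injective : Function.Injective (lineSite (L := L) i₀) :=
  Pi.single_injective (M := fun _ => ZMod L) i₀

@[simp] lemma lineSite_apply_self (z : ZMod L) : lineSite i₀ z i₀ = z := by simp [lineSite]

lemma lineEdge_injective : Function.Injective (lineEdge (L := L) i₀) :=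
  fun _ _ h => lineSite_injective i₀ (congrArg Prod.fst h)

@[simp] lemma lineChain_lineEdge (X : ZMod L → ZMod 2) (z : ZMod L) :
    lineChain i₀ X (lineEdge i₀ z) = X z := by
  simp [lineChain, lineEdge]

lemma lineChain_eq_zero (X : ZMod L → ZMod 2) {e : Edge d L} (h : ∀ z, lineEdge i₀ z ≠ e) :
    lineChain i₀ X e = 0 := if_neg fun h' => h _ h'.symm

lemma lineChain_add (X Y : ZMod L → ZMod 2) :
    lineChain i₀ (X + Y) = lineChain i₀ X + lineChain i₀ Y := by
  ext e
  by_cases h : ∃ z, lineEdge i₀ z = e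
  · obtain ⟨z, rfl⟩ := h; simp
  · push Not at h
    simp [lineChain_eq_zero i₀ _ h]

/-- The boundary of a chain on the ring `ZMod L`, whose value at `z` refers to the edge from `z` to
`z + 1`. -/
def ringBoundary (X : ZMod L → ZMod 2) : ZMod L → ZMod 2 := fun z => X z + X (z - 1)

lemma syndrome_lineChain_lineSite (X : ZMod L → ZMod 2) (z : ZMod L) :
    syndrome (lineChain i₀ X) (lineSite i₀ z) = ringBoundary X z := by
  rw [syndrome, Finset.sum_eq_single i₀]
  · have : lineSite i₀ z - Pi.single i₀ 1 = lineSite i₀ (z - 1) := by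
      rw [lineSite, lineSite, ← Pi.single_sub]
    rw [this]
    exact congrArg₂ (· + ·) (lineChain_lineEdge i₀ X z) (lineChain_lineEdge i₀ X (z - 1))
  · intro a _ ha
    rw [lineChain_eq_zero, lineChain_eq_zero, add_zero]
    all_goals exact fun w hw => ha (congrArg Prod.snd hw).symm
  · simp

lemma syndrome_lineChain_eq_zero (X : ZMod L → ZMod 2) {v : Site d L}
    (hv : ∀ z, lineSite i₀ z ≠ v) : syndrome (lineChain i₀ X) v = 0 := by
  refine Finset.sum_eq_zero fun a _ => ?_
  rw [lineChain_eq_zero, lineChain_eq_zero, add_zero]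
  · intro w hw
    obtain rfl : i₀ = a := congrArg Prod.snd hw
    have h1 : lineSite i₀ w = v - Pi.single i₀ 1 := congrArg Prod.fst hw
    refine hv (w + 1) ?_
    rw [lineSite, Pi.single_add, ← lineSite, h1, sub_add_cancel]
  · exact fun w hw => hv w (congrArg Prod.fst hw)

lemma winding_add [NeZero L] (x y : Chain d L) : winding (x + y) = winding x + winding y := by
  ext a
  simp [winding, Finset.sum_add_distrib]

lemma winding_lineChain [NeZero L] (X : ZMod L → ZMod 2) :
    winding (lineChain i₀ X) i₀ = X 0 := by
  rw [winding, Finset.sum_eq_single (lineSite i₀ 0)]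
  · exact lineChain_lineEdge i₀ X 0
  · intro v hv hne
    refine lineChain_eq_zero i₀ X fun z hz => hne ?_
    have h1 : lineSite i₀ z = v := congrArg Prod.fst hz
    have h2 : v i₀ = 0 := (Finset.mem_filter.1 hv).2
    rw [← h1, lineSite_apply_self] at h2
    rw [← h1, h2]
  · simp

lemma disp_lineSite (z w : ZMod L) :
    disp (lineSite i₀ z) (lineSite i₀ w) =
      EuclideanSpace.single i₀ (((w - z).valMinAbs : ℝ)) := by
  ext i
  by_cases h : i = i₀
  · subst h; simp [disp]
  · simp [disp, lineSite, h]

lemma pow_smul_disp_lineSite (α : ℝ) (z w : ZMod L) :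
    (‖disp (lineSite i₀ z) (lineSite i₀ w)‖ ^ (α + 1))⁻¹ • disp (lineSite i₀ z) (lineSite i₀ w) =
      ringForce α (w - z) • EuclideanSpace.single i₀ (1 : ℝ) := by
  rw [disp_lineSite, PiLp.norm_single, Real.norm_eq_abs, ringForce]
  ext i
  by_cases h : i = i₀
  · subst h; simp
  · simp [h]

section Step
variable [NeZero L] {I : Type*} (T : Finset I) (p : I → ZMod L)

lemma force_of_anyons_on_line (α : ℝ) (σ : Site d L → ZMod 2) (hinj : Set.InjOn p T)
    (hσ : anyons σ = T.image fun i => lineSite i₀ (p i)) (z : ZMod L) :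
    force α σ (lineSite i₀ z) =
      (∑ i ∈ T, ringForce α (p i - z)) • EuclideanSpace.single i₀ (1 : ℝ) := by
  have h0 : force α σ (lineSite i₀ z) = ∑ w ∈ anyons σ,
      (‖disp (lineSite i₀ z) w‖ ^ (α + 1))⁻¹ • disp (lineSite i₀ z) w := by
    refine Finset.sum_subset (Finset.erase_subset _ _) fun w hw hw' => ?_
    have : w = lineSite i₀ z := by
      by_contra h
      exact hw' (Finset.mem_erase.2 ⟨h, hw⟩)
    rw [this, pow_smul_disp_lineSite, sub_self, ringForce_zero, zero_smul]
  rw [h0, hσ, Finset.sum_image, Finset.sum_smul]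
  · exact Finset.sum_congr rfl fun i _ => pow_smul_disp_lineSite i₀ α z _
  · exact fun a ha b hb hab => hinj ha hb (lineSite_injective i₀ hab)

open Classical in
/-- If the anyons of a chain on a line are the distinct points `p i`, and the force on the one
at `p i` has the sign `s i`, then the decoder flips the edges of the line that the anyons cross. -/
lemma correction_lineChain {α : ℝ} {φ : EuclideanSpace ℝ (Fin d) → Dir d} (hφ : RespectsAxes φ)
    (X : ZMod L → ZMod 2) (hinj : Set.InjOn p T)
    (hX : ringBoundary X = ∑ i ∈ T, Pi.single (p i) 1) (s : I → ℤ)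
    (hs : ∀ i ∈ T, s i = 1 ∨ s i = -1)
    (hF : ∀ i ∈ T, 0 < s i * ∑ j ∈ T, ringForce α (p j - p i)) :
    correction α φ (syndrome (lineChain i₀ X)) = lineChain i₀ fun e =>
      if ∃ i ∈ T, (if s i = 1 then p i else p i - 1) = e then 1 else 0 := by
  set σ := syndrome (lineChain i₀ X) with hσ
  have hbd : ∀ z, ringBoundary X z ≠ 0 ↔ ∃ i ∈ T, p i = z := by
    intro z
    rw [hX, Finset.sum_apply]
    constructor
    · intro h
      obtain ⟨i, hi, h'⟩ := Finset.exists_ne_zero_of_sum_ne_zero h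
      refine ⟨i, hi, ?_⟩
      by_contra hne
      exact h' (Pi.single_eq_of_ne (Ne.symm hne) _)
    · rintro ⟨i, hi, rfl⟩
      rw [Finset.sum_eq_single_of_mem i hi]
      · simp
      · intro j hj hji
        exact Pi.single_eq_of_ne (fun h => hji (hinj hj hi h.symm)) _
  have hany : anyons σ = T.image fun i => lineSite i₀ (p i) := by
    ext v
    simp only [anyons, Finset.mem_filter, Finset.mem_univ, true_and, Finset.mem_image]
    by_cases h : ∃ z, lineSite i₀ z = v
    · obtain ⟨z, rfl⟩ := h
      rw [hσ, syndrome_lineChain_lineSite, hbd]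
      simp [(lineSite_injective i₀).eq_iff]
    · push Not at h
      rw [hσ, syndrome_lineChain_eq_zero i₀ X h]
      simp only [ne_eq, not_true_eq_false, false_iff]
      rintro ⟨i, -, hi⟩
      exact h _ hi
  have hcross : ∀ i ∈ T, crossedEdge (lineSite i₀ (p i)) (φ (force α σ (lineSite i₀ (p i)))) =
      lineEdge i₀ (if s i = 1 then p i else p i - 1) := by
    intro i hi
    rw [force_of_anyons_on_line i₀ T p α σ hinj hany]
    have h := hF i hi
    rcases hs i hi with h1 | h1
    · rw [h1, Int.cast_one, one_mul] at h
      have : φ ((∑ j ∈ T, ringForce α (p j - p i)) • EuclideanSpace.single i₀ (1 : ℝ)) =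
          (i₀, 1) := by
        rw [← hφ (i₀, 1) _ h, dirVec]; simp
      rw [this, h1, if_pos rfl]
      simp [crossedEdge, lineEdge]
    · rw [h1, Int.cast_neg, Int.cast_one, neg_one_mul] at h
      have : φ ((∑ j ∈ T, ringForce α (p j - p i)) • EuclideanSpace.single i₀ (1 : ℝ)) =
          (i₀, -1) := by
        rw [← hφ (i₀, -1) _ h, dirVec]
        congr 1
        ext k
        by_cases hk : k = i₀ <;> simp [hk]
      rw [this, h1, if_neg (by norm_num)]
      simp [crossedEdge, lineEdge, lineSite, Pi.single_sub]
  have key : ∀ e : Edge d L, (∃ v ∈ anyons σ, crossedEdge v (φ (force α σ v)) = e) ↔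
      ∃ i ∈ T, lineEdge i₀ (if s i = 1 then p i else p i - 1) = e := by
    intro e
    rw [hany]
    simp only [Finset.mem_image, exists_exists_and_eq_and]
    refine exists_congr fun i => and_congr_right fun hi => ?_
    rw [hcross i hi]
  ext e
  rw [correction]
  simp only [key]
  by_cases h : ∃ z, lineEdge i₀ z = e
  · obtain ⟨z, rfl⟩ := h
    rw [lineChain_lineEdge]
    simp only [(lineEdge_injective i₀).eq_iff]
  · push Not at h
    rw [lineChain_eq_zero i₀ _ h, if_neg]
    rintro ⟨i, -, hi⟩
    exact h _ hi

end Step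

lemma chainOf_empty : chainOf (∅ : Set (Edge d L)) = 0 := by
  ext e
  simp [chainOf]

open Classical in
lemma chainOf_lineEdge (A : Set (ZMod L)) :
    chainOf {e | ∃ z ∈ A, lineEdge i₀ z = e} = lineChain i₀ fun z => if z ∈ A then 1 else 0 := by
  ext e
  rw [chainOf]
  by_cases h : ∃ z, lineEdge i₀ z = e
  · obtain ⟨z, rfl⟩ := h
    simp [(lineEdge_injective i₀).eq_iff]
  · push Not at h
    rw [lineChain_eq_zero i₀ _ h, if_neg]
    rintro ⟨i, -, hi⟩
    exact h _ hi

end Line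

/-! ### Chains on the ring as sums of segments -/

section Segment
variable {L : ℕ}

/-- The chain on the ring that consists of the edge from `k` to `k + 1`, or the syndrome that
consists of the site `k`, where `k` is taken modulo `L`. -/
def ringPoint (L : ℕ) (k : ℤ) : ZMod L → ZMod 2 := Pi.single (k : ZMod L) 1

/-- The chain on the ring that consists of the edges from the site `u` to the site `v`. -/
noncomputable def segment (L : ℕ) (u v : ℤ) : ZMod L → ZMod 2 := ∑ k ∈ Finset.Ico u v, ringPoint L k

lemma chain_add_self {β : Type*} (x : β → ZMod 2) : x + x = 0 := by
  ext; simp [CharTwo.add_self_eq_zero]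

lemma ringBoundary_add (X Y : ZMod L → ZMod 2) :
    ringBoundary (X + Y) = ringBoundary X + ringBoundary Y := by
  ext z; simp only [ringBoundary, Pi.add_apply]; ring

lemma ringBoundary_sum {β : Type*} (s : Finset β) (f : β → ZMod L → ZMod 2) :
    ringBoundary (∑ b ∈ s, f b) = ∑ b ∈ s, ringBoundary (f b) := by
  ext z; simp [ringBoundary, Finset.sum_add_distrib]

lemma ringBoundary_ringPoint (k : ℤ) :
    ringBoundary (ringPoint L k) = ringPoint L k + ringPoint L (k + 1) := by
  ext z
  simp only [ringBoundary, ringPoint, Pi.add_apply, Pi.single_apply, Int.cast_add, Int.cast_one,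
    sub_eq_iff_eq_add]

lemma segment_succ_right {u v : ℤ} (h : u ≤ v) :
    segment L u (v + 1) = segment L u v + ringPoint L v := by
  have : Finset.Ico u (v + 1) = insert v (Finset.Ico u v) := by
    ext; simp only [Finset.mem_insert, Finset.mem_Ico]; omega
  rw [segment, this, Finset.sum_insert (by simp), add_comm, segment]

lemma segment_eq_add_left {u v : ℤ} (h : u < v) :
    segment L u v = ringPoint L u + segment L (u + 1) v := by
  have : Finset.Ico u v = insert u (Finset.Ico (u + 1) v) := by
    ext; simp only [Finset.mem_insert, Finset.mem_Ico]; omega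
  rw [segment, this, Finset.sum_insert (by simp), segment]

lemma ringBoundary_segment {u v : ℤ} (h : u ≤ v) :
    ringBoundary (segment L u v) = ringPoint L u + ringPoint L v := by
  induction v, h using Int.leInduction with
  | base =>
    rw [chain_add_self, segment, Finset.Ico_self, Finset.sum_empty]
    ext; simp [ringBoundary]
  | succ v h ih =>
    rw [segment_succ_right h, ringBoundary_add, ih, ringBoundary_ringPoint]
    have := chain_add_self (ringPoint L v)
    rw [add_assoc, ← add_assoc (ringPoint L v), this, zero_add]

lemma segment_add_segment {u v w : ℤ} (h : u ≤ v) (h' : v ≤ w) :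
    segment L u v + segment L v w = segment L u w := by
  induction w, h' using Int.leInduction with
  | base => simp [segment]
  | succ w h' ih => rw [segment_succ_right h', segment_succ_right (h.trans h'), ← ih, add_assoc]

/-- Flipping the edge crossed by the left end of a segment moves that end. -/
lemma segment_add_cross_left {u v s : ℤ} (h : u < v) (hs : s = 1 ∨ s = -1) :
    segment L u v + ringPoint L (if s = 1 then u else u - 1) = segment L (u + s) v := by
  rcases hs with rfl | rfl
  · rw [if_pos rfl, segment_eq_add_left h, add_comm, ← add_assoc, chain_add_self, zero_add]
  · rw [if_neg (by norm_num), add_comm, ← sub_eq_add_neg,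
      segment_eq_add_left (show u - 1 < v by omega), sub_add_cancel]

/-- Flipping the edge crossed by the right end of a segment moves that end. -/
lemma segment_add_cross_right {u v s : ℤ} (h : u < v) (hs : s = 1 ∨ s = -1) :
    segment L u v + ringPoint L (if s = 1 then v else v - 1) = segment L u (v + s) := by
  rcases hs with rfl | rfl
  · rw [if_pos rfl, segment_succ_right h.le]
  · have := segment_succ_right (L := L) (show u ≤ v - 1 by omega)
    rw [sub_add_cancel] at this
    rw [if_neg (by norm_num), this, add_assoc, chain_add_self, add_zero, sub_eq_add_neg]

open Classical in
/-- The indicator of a finite set of edges of the ring, as a sum without repetitions. -/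
lemma indicator_eq_sum_ringPoint {I : Type*} (T : Finset I) (c : I → ℤ)
    (hc : ∀ i ∈ T, ∀ j ∈ T, (c i : ZMod L) = c j → i = j) :
    (fun e : ZMod L => if ∃ i ∈ T, (c i : ZMod L) = e then (1 : ZMod 2) else 0) =
      ∑ i ∈ T, ringPoint L (c i) := by
  ext e
  rw [Finset.sum_apply]
  split_ifs with h
  · obtain ⟨i, hi, rfl⟩ := h
    rw [Finset.sum_eq_single_of_mem i hi]
    · simp [ringPoint]
    · intro j hj hji
      exact Pi.single_eq_of_ne (fun h => hji (hc i hi j hj h).symm) _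
  · refine (Finset.sum_eq_zero fun i hi => ?_).symm
    exact Pi.single_eq_of_ne (fun h' => h ⟨i, hi, h'.symm⟩) _

end Segment

/-! ### Dividing the ring into blocks -/

/-- The first site of block `k`, when the ring of `L` sites is divided evenly into `n` blocks and
unrolled to the infinite line. -/
def blockStart (L n : ℕ) (k : ℤ) : ℤ := k * L / n

section Blocks
variable {L n l : ℕ}

lemma blockStart_add_period (hn : 0 < n) (k : ℤ) :
    blockStart L n (k + n) = blockStart L n k + L := by
  have : (n : ℤ) ≠ 0 := by exact_mod_cast hn.ne'
  rw [blockStart, blockStart, add_mul, mul_comm (n : ℤ), Int.add_mul_ediv_right _ _ this]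

lemma blockStart_zero : blockStart L n 0 = 0 := by simp [blockStart]

lemma blockStart_period (hn : 0 < n) : blockStart L n n = L := by
  have := blockStart_add_period (L := L) hn 0
  rwa [zero_add, blockStart_zero, zero_add] at this

lemma blockStart_add_le (hn : 0 < n) (hl : l * n ≤ L) (k : ℤ) :
    blockStart L n k + l ≤ blockStart L n (k + 1) := by
  have h : (n : ℤ) ≠ 0 := by exact_mod_cast hn.ne'
  have hl' : (l : ℤ) * n ≤ L := by exact_mod_cast hl
  rw [blockStart, blockStart, ← Int.add_mul_ediv_right _ _ h]
  exact Int.ediv_le_ediv (by exact_mod_cast hn) (by linarith)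

lemma blockStart_le_add (hn : 0 < n) (hL : L ≤ (l + 1) * n) (k : ℤ) :
    blockStart L n (k + 1) ≤ blockStart L n k + l + 1 := by
  have h : (n : ℤ) ≠ 0 := by exact_mod_cast hn.ne'
  have hl' : (L : ℤ) ≤ (l + 1) * n := by exact_mod_cast hL
  rw [add_assoc, blockStart, blockStart, ← Int.add_mul_ediv_right _ _ h]
  exact Int.ediv_le_ediv (by exact_mod_cast hn) (by linarith)

lemma blockStart_mono (hn : 0 < n) : Monotone (blockStart L n) := by
  refine monotone_int_of_le_succ fun k => ?_
  have := blockStart_add_le (L := L) (l := 0) hn (by simp) k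
  push_cast at this
  linarith

lemma abs_blockStart_sub_le (hn : 0 < n) (k : ℤ) :
    |(blockStart L n k : ℝ) - k * ((L : ℝ) / n)| ≤ 1 := by
  have hn' : (0 : ℤ) < n := by exact_mod_cast hn
  have hn'' : (0 : ℝ) < n := by exact_mod_cast hn
  have h1 : ((k * L / n : ℤ) : ℝ) * n ≤ k * L := by
    exact_mod_cast Int.ediv_mul_le (k * L) hn'.ne'
  have h2 : (k : ℝ) * L < (((k * L / n : ℤ) : ℝ) + 1) * n := by
    exact_mod_cast Int.lt_ediv_add_one_mul_self (k * L) hn'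
  have e : (k : ℝ) * (L / n) = k * L / n := by ring
  rw [blockStart, e, abs_le]
  constructor
  · rw [le_sub_iff_add_le, ← sub_eq_neg_add, sub_le_iff_le_add, div_le_iff₀ hn'']
    exact h2.le
  · have : ((k * L / n : ℤ) : ℝ) ≤ k * L / n := by rwa [le_div_iff₀ hn'']
    linarith

/-- The blocks, each shifted by `s₀`, are disjoint modulo `L`. -/
lemma eq_of_cast_eq_of_mem_blocks (hn : 0 < n) {s₀ x y i j : ℤ}
    (hi : i ∈ Finset.Ico (0 : ℤ) n) (hj : j ∈ Finset.Ico (0 : ℤ) n)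
    (hx : blockStart L n i + s₀ ≤ x) (hx' : x < blockStart L n (i + 1) + s₀)
    (hy : blockStart L n j + s₀ ≤ y) (hy' : y < blockStart L n (j + 1) + s₀)
    (h : (x : ZMod L) = y) : i = j ∧ x = y := by
  rw [Finset.mem_Ico] at hi hj
  have hm := blockStart_mono (L := L) hn
  have h0 := blockStart_zero (L := L) (n := n)
  have hL := blockStart_period (L := L) hn
  have a1 := hm hi.1
  have a2 := hm hj.1
  have a3 := hm (show i + 1 ≤ n by omega)
  have a4 := hm (show j + 1 ≤ n by omega)
  have hxy : x = y := by
    rw [ZMod.intCast_eq_intCast_iff] at h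
    have h' : (x - s₀) ≡ (y - s₀) [ZMOD L] := h.sub_right s₀
    have e1 : (x - s₀) % L = x - s₀ := Int.emod_eq_of_lt (by omega) (by omega)
    have e2 : (y - s₀) % L = y - s₀ := Int.emod_eq_of_lt (by omega) (by omega)
    rw [Int.ModEq, e1, e2] at h'
    omega
  refine ⟨?_, hxy⟩
  rcases lt_trichotomy i j with hij | hij | hij
  · have := hm (show i + 1 ≤ j by omega); omega
  · exact hij
  · have := hm (show j + 1 ≤ i by omega); omega

variable {κ : Type*} [Fintype κ] [NeZero L]

/-- The dominance lemma for blocks that are separated by gaps of length at least `Δ`. -/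
lemma mul_sum_ringForce_pos_of_blocks {α : ℝ} (hα : 0 < α) (hn : 10 ≤ n) (hl : l * n ≤ L)
    (pos : ℤ → κ → ℤ) (hper : ∀ i q, pos (i + n) q = pos i q + L) {s₀ Δ : ℤ}
    (hlo : ∀ k q, blockStart L n k + s₀ ≤ pos k q)
    (hhi : ∀ k q, pos k q + Δ ≤ blockStart L n (k + 1) + s₀) (j : ℤ) (q₁ q₀ : κ)
    {D E : ℤ} (hD : 0 < D) (hE : 0 < E) (hEΔ : E ≤ Δ) (hEl : E ≤ l) {s : ℤ} (hs : s = 1 ∨ s = -1)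
    (h3 : s * (pos j q₀ - pos j q₁) = D)
    (h4 : ∀ q, 0 ≤ s * (pos j q - pos j q₁) ∨ E ≤ |pos j q - pos j q₁|)
    (h6 : 10 * Fintype.card κ * (E : ℝ) ^ (-α) < (D : ℝ) ^ (-α)) :
    0 < s * ∑ i ∈ Finset.Ico (0 : ℤ) n, ∑ q,
      ringForce α ((pos i q - pos j q₁ : ℤ) : ZMod L) := by
  have hn0 : 0 < n := by omega
  have hn0' : (0 : ℝ) < n := by exact_mod_cast hn0
  have hlam : (l : ℝ) ≤ (L : ℝ) / n := by
    rw [le_div_iff₀ hn0']; exact_mod_cast hl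
  have hE' : (E : ℝ) ≤ l := by exact_mod_cast hEl
  have hE1 : (1 : ℝ) ≤ E := by exact_mod_cast hE
  have hm := blockStart_mono (L := L) hn0
  refine mul_sum_ringForce_pos hα hn pos hper (pos j q₁) j hD hE hs q₀ ?_ ?_ h3 h4
    (hE'.trans hlam) h6
  · intro k q
    have a1 := abs_le.1 (abs_blockStart_sub_le (L := L) hn0 (j + k))
    have a2 := abs_le.1 (abs_blockStart_sub_le (L := L) hn0 (j + k + 1))
    have a3 := abs_le.1 (abs_blockStart_sub_le (L := L) hn0 j)
    have a4 := abs_le.1 (abs_blockStart_sub_le (L := L) hn0 (j + 1))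
    have b1 : (blockStart L n (j + k) : ℝ) + s₀ ≤ pos (j + k) q := by exact_mod_cast hlo (j + k) q
    have b2 : (pos (j + k) q : ℝ) + Δ ≤ blockStart L n (j + k + 1) + s₀ := by
      exact_mod_cast hhi (j + k) q
    have b3 : (blockStart L n j : ℝ) + s₀ ≤ pos j q₁ := by exact_mod_cast hlo j q₁
    have b4 : (pos j q₁ : ℝ) + Δ ≤ blockStart L n (j + 1) + s₀ := by exact_mod_cast hhi j q₁
    have b5 : (1 : ℝ) ≤ Δ := by exact_mod_cast (by omega : 1 ≤ Δ)
    push_cast at a1 a2 a3 a4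
    rw [abs_le]
    constructor <;> nlinarith
  · intro k hk _ q
    have b1 := hlo (j + k) q
    have b2 := hhi (j + k) q
    have b3 := hlo j q₁
    have b4 := hhi j q₁
    rcases lt_or_gt_of_ne hk with h | h
    · have := hm (show j + k + 1 ≤ j by omega)
      rw [abs_sub_comm, le_abs]; left; omega
    · have := hm (show j + 1 ≤ j + k by omega)
      rw [le_abs]; left; omega

open Classical in
/-- The correction step for a configuration of separated blocks in which every anyon moves towards
a dominant neighbour. -/
lemma correction_of_blocks {d : ℕ} (i₀ : Fin d) {α : ℝ} (hα : 0 < α)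
    {φ : EuclideanSpace ℝ (Fin d) → Dir d} (hφ : RespectsAxes φ)
    (hn : 10 ≤ n) (hl : l * n ≤ L)
    (pos : ℤ → κ → ℤ) (hper : ∀ i q, pos (i + n) q = pos i q + L) {s₀ Δ : ℤ}
    (hlo : ∀ k q, blockStart L n k + s₀ ≤ pos k q)
    (hhi : ∀ k q, pos k q + Δ ≤ blockStart L n (k + 1) + s₀)
    (hinj : ∀ k, Function.Injective (pos k)) (X : ZMod L → ZMod 2)
    (hX : ringBoundary X = ∑ i ∈ Finset.Ico (0 : ℤ) n, ∑ q, ringPoint L (pos i q))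
    (s : ℤ → κ → ℤ) (hs : ∀ j q, s j q = 1 ∨ s j q = -1)
    (hdom : ∀ j q₁, ∃ q₀, ∃ D E : ℤ, 0 < D ∧ 0 < E ∧ E ≤ Δ ∧ E ≤ l ∧
      s j q₁ * (pos j q₀ - pos j q₁) = D ∧
      (∀ q, 0 ≤ s j q₁ * (pos j q - pos j q₁) ∨ E ≤ |pos j q - pos j q₁|) ∧
      10 * Fintype.card κ * (E : ℝ) ^ (-α) < (D : ℝ) ^ (-α)) :
    correction α φ (syndrome (lineChain i₀ X)) = lineChain i₀ fun e =>
      if ∃ iq ∈ Finset.Ico (0 : ℤ) n ×ˢ (Finset.univ : Finset κ),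
        ((if s iq.1 iq.2 = 1 then pos iq.1 iq.2 else pos iq.1 iq.2 - 1 : ℤ) : ZMod L) = e
      then 1 else 0 := by
  rw [correction_lineChain i₀ (Finset.Ico (0 : ℤ) n ×ˢ (Finset.univ : Finset κ))
    (fun iq => (pos iq.1 iq.2 : ZMod L)) hφ X ?_ ?_ (fun iq => s iq.1 iq.2)
    (fun iq _ => hs _ _) ?_]
  · congr 1
    ext e
    congr 1
    rw [eq_iff_iff]
    refine exists_congr fun iq => and_congr_right fun _ => ?_
    split_ifs <;> push_cast <;> rfl
  · rintro ⟨i, q⟩ hi ⟨j, q'⟩ hj h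
    simp only [Finset.coe_product, Set.mem_prod, Finset.mem_coe] at hi hj
    obtain ⟨q₀, D, E, -, hE, hEΔ, -⟩ := hdom i q
    have a1 := hhi i q
    have a2 := hhi j q'
    obtain ⟨rfl, h'⟩ := eq_of_cast_eq_of_mem_blocks (by omega) hi.1 hj.1 (hlo i q)
      (by omega) (hlo j q') (by omega) h
    rw [hinj i h']
  · rw [hX, Finset.sum_product]
    rfl
  · rintro ⟨j, q₁⟩ -
    obtain ⟨q₀, D, E, hD, hE, hEΔ, hEl, h3, h4, h6⟩ := hdom j q₁
    have := mul_sum_ringForce_pos_of_blocks hα hn hl pos hper hlo hhi j q₁ q₀ hD hE hEΔ hEl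
      (hs j q₁) h3 h4 h6
    rw [Finset.sum_product]
    push_cast at this
    exact this

end Blocks

/-! ### One decoder step -/

/-- The edge whose flip creates a small pair of anyons at distance `y` from `z`, in the positive
direction if `s = 1` and in the negative direction otherwise. -/
def smallEdge (z s y : ℤ) : ℤ := if s = 1 then z + y else z - y - 1

lemma mul_rpow_neg_lt {α : ℝ} (hα : 0 < α) {c : ℝ} {C D F : ℤ} (hC0 : 0 < C)
    (hC : c * (C : ℝ) ^ (-α) < 1) (hD : 0 < D) (hDF : D ≤ F) (hc : 0 ≤ c) :
    c * ((C * F : ℤ) : ℝ) ^ (-α) < (D : ℝ) ^ (-α) := by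
  have hD' : (0 : ℝ) < D := by exact_mod_cast hD
  have hC' : (0 : ℝ) < C := by exact_mod_cast hC0
  have hDF' : (D : ℝ) ≤ F := by exact_mod_cast hDF
  push_cast
  rw [Real.mul_rpow hC'.le (hD'.le.trans hDF'), ← mul_assoc]
  have h1 := rpow_neg_antitone hα hD' hDF'
  have h2 : 0 < (D : ℝ) ^ (-α) := by positivity
  have h3 : 0 ≤ c * (C : ℝ) ^ (-α) := by positivity
  nlinarith

section PairStep
variable {d L n l : ℕ} [NeZero L] (i₀ : Fin d)

/-- In a configuration of one large pair per block, with one small pair next to each of its two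
anyons, every anyon has a dominant neighbour: the other anyon of the same small pair, or the
small pair next to it. -/
lemma exists_dominant {α : ℝ} (hα : 0 < α) {C F u v su sv yu yv : ℤ}
    (hC : 60 * (C : ℝ) ^ (-α) < 1) (hC2 : 2 ≤ C)
    (hsu : su = 1 ∨ su = -1) (hsv : sv = 1 ∨ sv = -1) (hyu : C ≤ yu) (hyu' : yu + 1 ≤ F)
    (hyv : C ≤ yv) (hyv' : yv + 1 ≤ F) (huv : C * F + F ≤ v - u) (q₁ : Fin 6) :
    ∃ q₀ : Fin 6, ∃ D E : ℤ, 0 < D ∧ 0 < E ∧ E ≤ C * F ∧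
      (![su, sv, 1, -1, 1, -1] : Fin 6 → ℤ) q₁ *
        ((![u, v, smallEdge u su yu, smallEdge u su yu + 1, smallEdge v sv yv,
          smallEdge v sv yv + 1] : Fin 6 → ℤ) q₀ -
        (![u, v, smallEdge u su yu, smallEdge u su yu + 1, smallEdge v sv yv,
          smallEdge v sv yv + 1] : Fin 6 → ℤ) q₁) = D ∧
      (∀ q, 0 ≤ (![su, sv, 1, -1, 1, -1] : Fin 6 → ℤ) q₁ *
        ((![u, v, smallEdge u su yu, smallEdge u su yu + 1, smallEdge v sv yv,
          smallEdge v sv yv + 1] : Fin 6 → ℤ) q -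
        (![u, v, smallEdge u su yu, smallEdge u su yu + 1, smallEdge v sv yv,
          smallEdge v sv yv + 1] : Fin 6 → ℤ) q₁) ∨
        E ≤ |(![u, v, smallEdge u su yu, smallEdge u su yu + 1, smallEdge v sv yv,
          smallEdge v sv yv + 1] : Fin 6 → ℤ) q -
        (![u, v, smallEdge u su yu, smallEdge u su yu + 1, smallEdge v sv yv,
          smallEdge v sv yv + 1] : Fin 6 → ℤ) q₁|) ∧
      10 * Fintype.card (Fin 6) * (E : ℝ) ^ (-α) < (D : ℝ) ^ (-α) := by
  have hCF : F + C ≤ C * F := by nlinarith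
  have e60 : 10 * ((Fintype.card (Fin 6) : ℕ) : ℝ) = 60 := by norm_num
  have hend : ∀ D : ℤ, 0 < D → D ≤ F → 10 * Fintype.card (Fin 6) * ((C * F : ℤ) : ℝ) ^ (-α) <
      (D : ℝ) ^ (-α) := by
    intro D hD hDF
    rw [e60]
    exact mul_rpow_neg_lt hα (by omega) hC hD hDF (by norm_num)
  have hsmall : 10 * Fintype.card (Fin 6) * (C : ℝ) ^ (-α) < ((1 : ℤ) : ℝ) ^ (-α) := by
    rw [e60, Int.cast_one, Real.one_rpow]; exact hC
  generalize hE : C * F = E at *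
  -- the far anyon of the small pair next to an end of the large pair
  have hfar : ∀ s : ℤ, s = 1 ∨ s = -1 → ∀ z y : ℤ, (s = 1 → s * (smallEdge z s y + 1 - z) = y + 1) ∧
      (s = -1 → s * (smallEdge z s y - z) = y + 1) := by
    rintro s (rfl | rfl) z y
    · exact ⟨fun _ => by rw [smallEdge, if_pos rfl]; ring, fun h => by omega⟩
    · exact ⟨fun h => by omega, fun _ => by rw [smallEdge, if_neg (by norm_num)]; ring⟩
  fin_cases q₁
  on_goal 1 =>
    refine ⟨if su = 1 then 3 else 2, yu + 1, E, by omega, by omega, le_rfl, ?_, ?_,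
      hend _ (by omega) hyu'⟩
    · rcases hsu with rfl | rfl
      · exact (hfar 1 (Or.inl rfl) u yu).1 rfl
      · exact (hfar (-1) (Or.inr rfl) u yu).2 rfl
  on_goal 2 =>
    refine ⟨if sv = 1 then 5 else 4, yv + 1, E, by omega, by omega, le_rfl, ?_, ?_,
      hend _ (by omega) hyv'⟩
    · rcases hsv with rfl | rfl
      · exact (hfar 1 (Or.inl rfl) v yv).1 rfl
      · exact (hfar (-1) (Or.inr rfl) v yv).2 rfl
  on_goal 3 => refine ⟨3, 1, C, by omega, by omega, by omega, by simp, ?_, hsmall⟩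
  on_goal 4 => refine ⟨2, 1, C, by omega, by omega, by omega, by simp, ?_, hsmall⟩
  on_goal 5 => refine ⟨5, 1, C, by omega, by omega, by omega, by simp, ?_, hsmall⟩
  on_goal 6 => refine ⟨4, 1, C, by omega, by omega, by omega, by simp, ?_, hsmall⟩
  all_goals
    rw [Fin.forall_fin_succ, Fin.forall_fin_succ, Fin.forall_fin_succ, Fin.forall_fin_succ,
      Fin.forall_fin_succ, Fin.forall_fin_one]
    rcases hsu with rfl | rfl <;> rcases hsv with rfl | rfl <;>
      simp [smallEdge, le_abs] <;> omega

/-- **A controlled step.** If the noise adds a small pair next to each anyon of the large pair of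
every block, then these anyons move by one site towards the small pairs, which annihilate. The constant `60` is
`10` for each of the six anyons per block, as in `mul_sum_ringForce_pos`. -/
lemma pair_step {α : ℝ} (hα : 0 < α) {φ : EuclideanSpace ℝ (Fin d) → Dir d}
    (hφ : RespectsAxes φ) (hn : 10 ≤ n) (hl : l * n ≤ L) {C F Δ : ℤ}
    (hC : 60 * (C : ℝ) ^ (-α) < 1) (hC2 : 2 ≤ C) (hΔ : C * F ≤ Δ) (hlF : C * F ≤ l)
    (u v su sv yu yv : ℤ → ℤ)
    (hper : ∀ k, u (k + n) = u k + L ∧ v (k + n) = v k + L ∧ su (k + n) = su k ∧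
      sv (k + n) = sv k ∧ yu (k + n) = yu k ∧ yv (k + n) = yv k)
    (hsu : ∀ k, su k = 1 ∨ su k = -1) (hsv : ∀ k, sv k = 1 ∨ sv k = -1)
    (hyu : ∀ k, C ≤ yu k) (hyu' : ∀ k, yu k + 1 ≤ F)
    (hyv : ∀ k, C ≤ yv k) (hyv' : ∀ k, yv k + 1 ≤ F) (huv : ∀ k, C * F + F ≤ v k - u k)
    (hlo : ∀ k, blockStart L n k ≤ u k - F) (hhi : ∀ k, v k + F + Δ ≤ blockStart L n (k + 1)) :
    let X : ZMod L → ZMod 2 := ∑ k ∈ Finset.Ico (0 : ℤ) n, (segment L (u k) (v k) +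
      (ringPoint L (smallEdge (u k) (su k) (yu k)) + ringPoint L (smallEdge (v k) (sv k) (yv k))))
    lineChain i₀ X + correction α φ (syndrome (lineChain i₀ X)) =
      lineChain i₀ (∑ k ∈ Finset.Ico (0 : ℤ) n, segment L (u k + su k) (v k + sv k)) := by
  classical
  intro X
  have hF : 0 < F := by linarith [hyu 0, hyu' 0]
  have hCF : F + C ≤ C * F := by nlinarith [hyu 0, hyu' 0]
  let pos : ℤ → Fin 6 → ℤ := fun k => ![u k, v k, smallEdge (u k) (su k) (yu k),
    smallEdge (u k) (su k) (yu k) + 1, smallEdge (v k) (sv k) (yv k),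
    smallEdge (v k) (sv k) (yv k) + 1]
  let sgn : ℤ → Fin 6 → ℤ := fun k => ![su k, sv k, 1, -1, 1, -1]
  let c : ℤ → Fin 4 → ℤ := fun k => ![if su k = 1 then u k else u k - 1,
    if sv k = 1 then v k else v k - 1, smallEdge (u k) (su k) (yu k),
    smallEdge (v k) (sv k) (yv k)]
  have hX : ringBoundary X = ∑ i ∈ Finset.Ico (0 : ℤ) n, ∑ q, ringPoint L (pos i q) := by
    rw [ringBoundary_sum]
    refine Finset.sum_congr rfl fun k _ => ?_
    have := huv k
    rw [ringBoundary_add, ringBoundary_add, ringBoundary_segment (by omega),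
      ringBoundary_ringPoint, ringBoundary_ringPoint]
    simp [pos, Fin.sum_univ_succ]
    abel
  have hcorr := correction_of_blocks i₀ hα hφ hn hl pos (s₀ := 0) (Δ := Δ) ?_ ?_ ?_ ?_ X hX sgn
    ?_ ?_
  · have hcross : ∀ e : ZMod L, (∃ iq ∈ Finset.Ico (0 : ℤ) n ×ˢ (Finset.univ : Finset (Fin 6)),
        ((if sgn iq.1 iq.2 = 1 then pos iq.1 iq.2 else pos iq.1 iq.2 - 1 : ℤ) : ZMod L) = e) ↔
        ∃ iq ∈ Finset.Ico (0 : ℤ) n ×ˢ (Finset.univ : Finset (Fin 4)),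
          (c iq.1 iq.2 : ZMod L) = e := by
      intro e
      constructor
      · rintro ⟨⟨k, q⟩, hk, rfl⟩
        have hk' := (Finset.mem_product.1 hk).1
        fin_cases q
        · exact ⟨(k, 0), Finset.mem_product.2 ⟨hk', Finset.mem_univ _⟩, rfl⟩
        · exact ⟨(k, 1), Finset.mem_product.2 ⟨hk', Finset.mem_univ _⟩, rfl⟩
        · exact ⟨(k, 2), Finset.mem_product.2 ⟨hk', Finset.mem_univ _⟩, by simp [c, sgn, pos]⟩
        · exact ⟨(k, 2), Finset.mem_product.2 ⟨hk', Finset.mem_univ _⟩, by simp [c, sgn, pos]⟩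
        · exact ⟨(k, 3), Finset.mem_product.2 ⟨hk', Finset.mem_univ _⟩, by simp [c, sgn, pos]⟩
        · exact ⟨(k, 3), Finset.mem_product.2 ⟨hk', Finset.mem_univ _⟩, by simp [c, sgn, pos]⟩
      · rintro ⟨⟨k, q⟩, hk, rfl⟩
        have hk' := (Finset.mem_product.1 hk).1
        fin_cases q
        · exact ⟨(k, 0), Finset.mem_product.2 ⟨hk', Finset.mem_univ _⟩, rfl⟩
        · exact ⟨(k, 1), Finset.mem_product.2 ⟨hk', Finset.mem_univ _⟩, rfl⟩
        · exact ⟨(k, 2), Finset.mem_product.2 ⟨hk', Finset.mem_univ _⟩, by simp [c, sgn, pos]⟩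
        · exact ⟨(k, 4), Finset.mem_product.2 ⟨hk', Finset.mem_univ _⟩, by simp [c, sgn, pos]⟩
    simp only [hcross] at hcorr
    rw [hcorr, indicator_eq_sum_ringPoint _ (fun iq : ℤ × Fin 4 => c iq.1 iq.2), ← lineChain_add]
    · congr 1
      rw [Finset.sum_product, ← Finset.sum_add_distrib]
      refine Finset.sum_congr rfl fun k _ => ?_
      have := huv k
      have := hyu k
      have h1 := segment_add_cross_left (L := L) (show u k < v k by omega) (hsu k)
      have h2 := segment_add_cross_right (L := L) (u := u k + su k) (v := v k) (s := sv k)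
        (by rcases hsu k with h | h <;> omega) (hsv k)
      have h3 := chain_add_self (ringPoint L (smallEdge (u k) (su k) (yu k)))
      have h4 := chain_add_self (ringPoint L (smallEdge (v k) (sv k) (yv k)))
      simp only [c, Fin.sum_univ_four, Matrix.cons_val]
      rw [← h2, ← h1]
      linear_combination h3 + h4
    · rintro ⟨k, q⟩ hk ⟨k', q'⟩ hk' h
      have hb : ∀ k q, blockStart L n k + 0 ≤ c k q ∧ c k q < blockStart L n (k + 1) + 0 := by
        intro k q
        have := hlo k; have := hhi k; have := huv k
        have := hyu k; have := hyu' k; have := hyv k; have := hyv' k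
        fin_cases q <;> simp [c, smallEdge] <;> split_ifs <;> omega
      obtain ⟨rfl, h'⟩ := eq_of_cast_eq_of_mem_blocks (by omega) (Finset.mem_product.1 hk).1
        (Finset.mem_product.1 hk').1 (hb k q).1 (hb k q).2 (hb k' q').1 (hb k' q').2 h
      have := huv k
      have := hyu k; have := hyu' k; have := hyv k; have := hyv' k
      congr 1
      rcases hsu k with h1 | h1 <;> rcases hsv k with h2 | h2 <;> fin_cases q <;> fin_cases q' <;>
        first | rfl | (exfalso; simp [c, smallEdge, h1, h2] at h'; omega)
  · intro k q
    obtain ⟨h1, h2, h3, h4, h5, h6⟩ := hper k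
    fin_cases q <;> simp [pos, h1, h2, h3, h4, h5, h6, smallEdge] <;> split_ifs <;> omega
  · intro k q
    have := hlo k; have := huv k
    have := hyu k; have := hyu' k; have := hyv k; have := hyv' k
    fin_cases q <;> simp [pos, smallEdge] <;> (try split_ifs) <;> omega
  · intro k q
    have := hhi k; have := huv k
    have := hyu k; have := hyu' k; have := hyv k; have := hyv' k
    fin_cases q <;> simp [pos, smallEdge] <;> (try split_ifs) <;> omega
  · intro k q q' h'
    have := huv k
    have := hyu k; have := hyu' k; have := hyv k; have := hyv' k
    rcases hsu k with h1 | h1 <;> rcases hsv k with h2 | h2 <;> fin_cases q <;> fin_cases q' <;>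
      first | rfl | (exfalso; simp [pos, smallEdge, h1, h2] at h' <;> omega)
  · intro k q
    fin_cases q <;> simp [sgn, hsu k, hsv k]
  · intro k q₁
    obtain ⟨q₀, D, E, h1, h2, h3, h4, h5, h6⟩ := exists_dominant hα hC hC2 (hsu k) (hsv k) (hyu k)
      (hyu' k) (hyv k) (hyv' k) (huv k) q₁
    exact ⟨q₀, D, E, h1, h2, h3.trans hΔ, h3.trans hlF, h4, h5, h6⟩

end PairStep

/-! ### Closing the gaps -/

section Closing
variable {d L n l : ℕ} [NeZero L] (i₀ : Fin d)

lemma segment_full (u : ℤ) : segment L u (u + L) = 1 := by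
  classical
  rw [segment, ← indicator_eq_sum_ringPoint (Finset.Ico u (u + L)) (fun k => k)]
  · ext e
    rw [if_pos, Pi.one_apply]
    refine ⟨u + (e - (u : ZMod L)).val, ?_, by push_cast; rw [ZMod.natCast_zmod_val]; ring⟩
    have := ZMod.val_lt (e - (u : ZMod L))
    rw [Finset.mem_Ico]
    omega
  · intro i hi j hj h
    rw [Finset.mem_Ico] at hi hj
    rw [ZMod.intCast_eq_intCast_iff] at h
    have h' : (i - u) ≡ (j - u) [ZMOD L] := h.sub_right u
    rw [Int.ModEq, Int.emod_eq_of_lt (by omega) (by omega),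
      Int.emod_eq_of_lt (by omega) (by omega)] at h'
    omega

/-- The large pairs and the gaps between them cover the ring. -/
lemma sum_segment_eq_one_add (u v : ℤ → ℤ) (hu : ∀ k, u (k + n) = u k + L)
    (huv : ∀ k, u k ≤ v k) (hvu : ∀ k, v k ≤ u (k + 1)) :
    ∑ k ∈ Finset.Ico (0 : ℤ) n, segment L (u k) (v k) =
      1 + ∑ k ∈ Finset.Ico (0 : ℤ) n, segment L (v k) (u (k + 1)) := by
  have hmono : Monotone u := monotone_int_of_le_succ fun k => (huv k).trans (hvu k)
  have htel : ∀ m : ℕ, ∑ k ∈ Finset.Ico (0 : ℤ) m, segment L (u k) (u (k + 1)) =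
      segment L (u 0) (u m) := by
    intro m
    induction m with
    | zero => simp [segment]
    | succ m ih =>
      have : Finset.Ico (0 : ℤ) (m + 1 : ℕ) = insert (m : ℤ) (Finset.Ico (0 : ℤ) m) := by
        ext; simp only [Finset.mem_insert, Finset.mem_Ico]; omega
      rw [this, Finset.sum_insert (by simp), ih, add_comm,
        segment_add_segment (hmono (by omega)) (hmono (by omega))]
      push_cast
      rfl
  have h1 := htel n
  have h2 := hu 0
  rw [zero_add] at h2
  rw [h2, segment_full] at h1
  rw [← h1, ← Finset.sum_add_distrib]
  refine Finset.sum_congr rfl fun k _ => ?_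
  rw [← segment_add_segment (huv k) (hvu k), add_assoc, chain_add_self, add_zero]

/-- **A closing step.** If all gaps between the large pairs are short, the decoder shrinks each of
them by one edge at both ends. -/
lemma closing_step {α : ℝ} (hα : 0 < α) {φ : EuclideanSpace ℝ (Fin d) → Dir d}
    (hφ : RespectsAxes φ) (hn : 10 ≤ n) (hl : l * n ≤ L) {C F s₀ Δ : ℤ}
    (hC : 60 * (C : ℝ) ^ (-α) < 1) (hC2 : 2 ≤ C) (hΔ : C * F ≤ Δ) (hlF : C * F ≤ l)
    (a c : ℤ → ℤ) (hper : ∀ k, a (k + n) = a k + L ∧ c (k + n) = c k + L)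
    (hac : ∀ k, a k < c k) (hacF : ∀ k, c k - a k ≤ F)
    (hlo : ∀ k, blockStart L n k + s₀ ≤ a k)
    (hhi : ∀ k, c k + Δ ≤ blockStart L n (k + 1) + s₀) :
    let X : ZMod L → ZMod 2 := 1 + ∑ k ∈ Finset.Ico (0 : ℤ) n, segment L (a k) (c k)
    lineChain i₀ X + correction α φ (syndrome (lineChain i₀ X)) =
      lineChain i₀ (1 + ∑ k ∈ Finset.Ico (0 : ℤ) n, segment L (a k + 1) (c k - 1)) := by
  classical
  intro X
  have hF : 0 < F := by have := hac 0; have := hacF 0; omega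
  have hCF : 0 < C * F := by positivity
  let pos : ℤ → Fin 2 → ℤ := fun k => ![a k, c k]
  let sgn : ℤ → Fin 2 → ℤ := fun _ => ![1, -1]
  have hX : ringBoundary X = ∑ i ∈ Finset.Ico (0 : ℤ) n, ∑ q, ringPoint L (pos i q) := by
    have h1 : ringBoundary (1 : ZMod L → ZMod 2) = 0 := by
      ext; simp [ringBoundary, CharTwo.add_self_eq_zero]
    rw [ringBoundary_add, h1, zero_add, ringBoundary_sum]
    refine Finset.sum_congr rfl fun k _ => ?_
    rw [ringBoundary_segment (hac k).le]
    simp [pos]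
  have hcorr := correction_of_blocks i₀ hα hφ hn hl pos (s₀ := s₀) (Δ := Δ) ?_ ?_ ?_ ?_ X hX sgn
    ?_ ?_
  · -- the crossed edges; those of a gap of length one coincide
    let T : Finset ℤ := (Finset.Ico (0 : ℤ) n).biUnion fun k => {a k, c k - 1}
    have hcross : ∀ e : ZMod L, (∃ iq ∈ Finset.Ico (0 : ℤ) n ×ˢ (Finset.univ : Finset (Fin 2)),
        ((if sgn iq.1 iq.2 = 1 then pos iq.1 iq.2 else pos iq.1 iq.2 - 1 : ℤ) : ZMod L) = e) ↔
        ∃ x ∈ T, (x : ZMod L) = e := by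
      intro e
      simp only [T, Finset.mem_biUnion, Finset.mem_insert, Finset.mem_singleton]
      constructor
      · rintro ⟨⟨k, q⟩, hk, rfl⟩
        have hk' := (Finset.mem_product.1 hk).1
        fin_cases q
        · exact ⟨a k, ⟨k, hk', Or.inl rfl⟩, rfl⟩
        · exact ⟨c k - 1, ⟨k, hk', Or.inr rfl⟩, rfl⟩
      · rintro ⟨x, ⟨k, hk, rfl | rfl⟩, rfl⟩
        · exact ⟨(k, 0), Finset.mem_product.2 ⟨hk, Finset.mem_univ _⟩, rfl⟩
        · exact ⟨(k, 1), Finset.mem_product.2 ⟨hk, Finset.mem_univ _⟩, rfl⟩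
    have hb : ∀ k, ∀ x ∈ ({a k, c k - 1} : Finset ℤ), blockStart L n k + s₀ ≤ x ∧
        x < blockStart L n (k + 1) + s₀ := by
      intro k x hx
      have := hlo k; have := hhi k; have := hac k
      rw [Finset.mem_insert, Finset.mem_singleton] at hx
      omega
    have hb' : ∀ i ∈ Finset.Ico (0 : ℤ) n, ∀ x ∈ ({a i, c i - 1} : Finset ℤ),
        ∀ j ∈ Finset.Ico (0 : ℤ) n, ∀ y ∈ ({a j, c j - 1} : Finset ℤ),
        (x : ZMod L) = y → i = j ∧ x = y := fun i hi x hx j hj y hy h =>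
      eq_of_cast_eq_of_mem_blocks (by omega) hi hj (hb i x hx).1 (hb i x hx).2 (hb j y hy).1
        (hb j y hy).2 h
    simp only [hcross] at hcorr
    rw [hcorr, indicator_eq_sum_ringPoint T (fun x => x), ← lineChain_add, Finset.sum_biUnion]
    · congr 1
      rw [add_assoc, ← Finset.sum_add_distrib]
      congr 1
      refine Finset.sum_congr rfl fun k _ => ?_
      have := hac k
      have hset : Finset.Ico (a k) (c k) =
          {a k, c k - 1} ∪ Finset.Ico (a k + 1) (c k - 1) := by
        ext; simp only [Finset.mem_union, Finset.mem_insert, Finset.mem_singleton,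
          Finset.mem_Ico]; omega
      rw [segment, hset, Finset.sum_union, add_comm, ← add_assoc, chain_add_self, zero_add,
        segment]
      rw [Finset.disjoint_left]
      intro x
      simp only [Finset.mem_insert, Finset.mem_singleton, Finset.mem_Ico]
      omega
    · intro i hi j hj hij
      rw [Function.onFun, Finset.disjoint_left]
      intro x hx hx'
      exact hij (hb' i hi x hx j hj x hx' rfl).1
    · intro x hx y hy h
      obtain ⟨i, hi, hx'⟩ := Finset.mem_biUnion.1 hx
      obtain ⟨j, hj, hy'⟩ := Finset.mem_biUnion.1 hy
      exact (hb' i hi x hx' j hj y hy' h).2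
  · intro k q
    fin_cases q <;> simp [pos, hper k]
  · intro k q
    have := hlo k; have := hac k
    fin_cases q <;> simp [pos] <;> omega
  · intro k q
    have := hhi k; have := hac k
    fin_cases q <;> simp [pos] <;> omega
  · intro k q q' h'
    have := hac k
    fin_cases q <;> fin_cases q' <;> first | rfl | (exfalso; simp [pos] at h'; omega)
  · intro k q
    fin_cases q <;> simp [sgn]
  · intro k q₁
    have h0 := hac k
    have h20 : 10 * Fintype.card (Fin 2) * ((C * F : ℤ) : ℝ) ^ (-α) <
        ((c k - a k : ℤ) : ℝ) ^ (-α) := by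
      refine mul_rpow_neg_lt hα (by omega) ?_ (by omega) (hacF k) (by positivity)
      have : (0 : ℝ) < (C : ℝ) ^ (-α) :=
        Real.rpow_pos_of_pos (by exact_mod_cast (by omega : 0 < C)) _
      norm_num
      linarith
    fin_cases q₁
    · refine ⟨1, c k - a k, C * F, by omega, hCF, hΔ, hlF, by simp [sgn, pos], fun q => ?_, h20⟩
      left
      fin_cases q <;> simp [sgn, pos]
      omega
    · refine ⟨0, c k - a k, C * F, by omega, hCF, hΔ, hlF, by simp [sgn, pos], fun q => ?_, h20⟩
      left
      fin_cases q <;> simp [sgn, pos]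
      omega

end Closing

/-! ### The schedule of the noise in one block -/

/-- The parameters of the noise: anyons at `C` times the distance are negligible, each small pair
is placed by the noise at one of up to `K` positions, and each large pair starts from one of `M`
positions in its block. -/
structure Design where
  C : ℕ
  K : ℕ
  M : ℕ

namespace Design
variable (P : Design)

/-- The length of the initial large pairs. -/
def seed : ℕ := (P.C + 1) ^ 2

/-- The number of initial growth steps, in which the noise has fewer than `K` choices. -/
def growTime : ℕ := P.C * P.K

/-- A bound for the distance of the small pairs from the anyons of a large pair. -/
def reach : ℕ := P.C + P.K

/-- The length of the large pairs after the initial growth. -/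
def width : ℕ := P.seed + 2 * P.growTime

/-- Half the spacing of the possible initial positions of a large pair. -/
def room : ℕ := P.width + 2 * P.reach

/-- Half the number of steps in which the large pairs are moved to their final position. -/
def half : ℕ := (P.M - 1) * P.room

/-- The minimal distance between the anyons of different blocks as long as there is noise. -/
def margin : ℕ := 2 * P.C * P.reach + 1

/-- The minimal length of a block. -/
def blockLen : ℕ := 2 * P.reach + 4 * P.half + P.width + P.margin

/-- The number of steps in which the noise acts. -/
def noiseTime : ℕ := P.growTime + 4 * P.half

/-- The number of steps after which the gaps have closed without noise. -/
def closeTime : ℕ := (P.C + 1) * P.reach + 1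

/-- The number of positions from which the noise chooses one for a small pair at time `t`. As long as
it is less than `K` it grows in proportion to the length of the large pair, because the small pairs
have to be much closer to the anyons of the large pair than these are to each other. -/
def window (t : ℕ) : ℕ := if t < P.growTime then 1 + t / P.C else P.K

/-- The parameter `a` in `left` and `right` for the initial position number `m` of a large pair, which
is `2 * (half - a) = 2 * m * room` sites to the right of the initial position number `0`. -/
def shift (m : ℕ) : ℤ := P.half - m * P.room

/-- The left anyon of the large pair of a block at time `t`, relative to the start of the block: it
moves left while the pair grows; then the pair moves right for `half + a` steps and back to the left
for `half - a` steps, which takes it to a position that does not depend on `a`, after a time that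
does not depend on `a` either; then the anyon moves left again, while the pair grows. -/
def left (a t : ℤ) : ℤ :=
  if t ≤ P.growTime then P.reach + 2 * (P.half - a) + P.growTime - t
  else if t ≤ P.growTime + 2 * P.half then P.reach + 2 * (P.half - a) +
    min (t - P.growTime) (2 * P.half + 2 * a - (t - P.growTime))
  else P.reach + 4 * P.half - (t - P.growTime)

/-- The right anyon of the large pair of a block at time `t`, relative to the start of the block. -/
def right (a t : ℤ) : ℤ :=
  if t ≤ P.growTime then P.reach + 2 * (P.half - a) + P.growTime + P.seed + t
  else if t ≤ P.growTime + 2 * P.half then P.reach + 2 * (P.half - a) + P.width +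
    min (t - P.growTime) (2 * P.half + 2 * a - (t - P.growTime))
  else P.reach + P.width + (t - P.growTime)

/-- The direction in which the left anyon moves at time `t`. -/
def leftDir (a t : ℤ) : ℤ := P.left a (t + 1) - P.left a t

/-- The direction in which the right anyon moves at time `t`. -/
def rightDir (a t : ℤ) : ℤ := P.right a (t + 1) - P.right a t

lemma width_eq : P.width = P.seed + 2 * P.growTime := rfl

lemma room_eq : P.room = P.width + 2 * P.reach := rfl

lemma blockLen_eq : P.blockLen = 2 * P.reach + 4 * P.half + P.width + P.margin := rfl

lemma noiseTime_eq : P.noiseTime = P.growTime + 4 * P.half := rfl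

section Path
variable {P} {a t : ℤ}

lemma leftDir_eq (ha : 0 ≤ a) (ha' : a ≤ P.half) (ht : t < P.noiseTime) :
    P.leftDir a t = 1 ∨ P.leftDir a t = -1 := by
  have := P.noiseTime_eq
  unfold leftDir left
  split_ifs <;> omega

lemma rightDir_eq (ha : 0 ≤ a) (ha' : a ≤ P.half) (ht : t < P.noiseTime) :
    P.rightDir a t = 1 ∨ P.rightDir a t = -1 := by
  have := P.noiseTime_eq
  have := P.width_eq
  unfold rightDir right
  split_ifs <;> omega

lemma leftDir_of_lt (ht : t < P.growTime) : P.leftDir a t = -1 := by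
  unfold leftDir left
  split_ifs <;> omega

lemma rightDir_of_lt (ht : t < P.growTime) : P.rightDir a t = 1 := by
  unfold rightDir right
  split_ifs <;> omega

lemma left_add_leftDir : P.left a t + P.leftDir a t = P.left a (t + 1) := by
  unfold leftDir; ring

lemma right_add_rightDir : P.right a t + P.rightDir a t = P.right a (t + 1) := by
  unfold rightDir; ring

lemma reach_le_left (ha' : a ≤ P.half) (ht : t ≤ P.noiseTime) :
    P.reach ≤ P.left a t := by
  have := P.noiseTime_eq
  unfold left
  split_ifs <;> omega

lemma right_le (ha : 0 ≤ a) (ht : t ≤ P.noiseTime) :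
    P.right a t ≤ P.reach + 4 * P.half + P.width := by
  have := P.noiseTime_eq
  have := P.width_eq
  unfold right
  split_ifs <;> omega

lemma seed_add_le :
    P.seed + 2 * min t P.growTime ≤ P.right a t - P.left a t := by
  have := P.width_eq
  unfold right left
  split_ifs <;> omega

lemma left_noiseTime (ha : 0 ≤ a) (ha' : a ≤ P.half) : P.left a P.noiseTime = P.reach := by
  have := P.noiseTime_eq
  unfold left
  split_ifs <;> omega

lemma right_noiseTime (ha : 0 ≤ a) (ha' : a ≤ P.half) :
    P.right a P.noiseTime = P.reach + 4 * P.half + P.width := by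
  have := P.noiseTime_eq
  have := P.width_eq
  unfold right
  split_ifs <;> omega

lemma left_zero : P.left a 0 = P.reach + 2 * (P.half - a) + P.growTime := by
  unfold left
  rw [if_pos (by omega), sub_zero]

lemma right_zero : P.right a 0 = P.left a 0 + P.seed := by
  rw [left_zero]
  unfold right
  rw [if_pos (by omega), add_zero]

lemma left_of_lt (ht : t < P.growTime) :
    P.left a t = P.reach + 2 * (P.half - a) + P.growTime - t := by
  unfold left
  rw [if_pos ht.le]

lemma right_of_lt (ht : t < P.growTime) :
    P.right a t = P.reach + 2 * (P.half - a) + P.growTime + P.seed + t := by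
  unfold right
  rw [if_pos ht.le]

end Path

section Window
variable {P}

lemma shift_nonneg {m : ℕ} (hm : m < P.M) : 0 ≤ P.shift m := by
  have h : m * P.room ≤ P.half := Nat.mul_le_mul_right _ (by omega)
  have h' : ((m * P.room : ℕ) : ℤ) ≤ P.half := by exact_mod_cast h
  unfold shift
  push_cast at h'
  linarith

lemma shift_le (m : ℕ) : P.shift m ≤ P.half := by
  have : (0 : ℤ) ≤ m * P.room := by positivity
  unfold shift
  linarith

lemma window_pos (hK : 0 < P.K) (t : ℕ) : 0 < P.window t := by
  unfold window
  split_ifs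
  exacts [Nat.add_pos_left one_pos _, hK]

lemma window_le (t : ℕ) : P.window t ≤ P.K := by
  unfold window
  split_ifs with h
  · have : t / P.C < P.K := Nat.div_lt_of_lt_mul h
    rw [add_comm]
    exact this
  · exact le_rfl

/-- The large pair is long in comparison with the distance of the small pairs. -/
lemma mul_window_le (hC : 0 < P.C) (t : ℕ) :
    (P.C + 1) * (P.C + P.window t) ≤ P.seed + 2 * min t P.growTime := by
  unfold window seed
  split_ifs with h
  · have h1 : P.C * (t / P.C) ≤ t := Nat.mul_div_le t P.C
    have h2 : t / P.C ≤ t := Nat.div_le_self t P.C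
    rw [min_eq_left h.le]
    nlinarith
  · rw [min_eq_right (by omega), growTime]
    nlinarith

/-- The number of choices in the initial growth: `1, …, K`, each of them `C` times. -/
lemma prod_window (hC : 0 < P.C) :
    ∏ t ∈ Finset.range P.growTime, P.window t = (P.K.factorial) ^ P.C := by
  have key : ∀ k : ℕ, ∏ t ∈ Finset.range (P.C * k), (1 + t / P.C) = (k.factorial) ^ P.C := by
    intro k
    induction k with
    | zero => simp
    | succ k ih =>
      rw [Nat.mul_succ, Finset.prod_range_add, ih, Nat.factorial_succ, mul_pow, mul_comm]
      congr 1
      rw [Finset.prod_congr rfl (g := fun _ => k + 1), Finset.prod_const, Finset.card_range]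
      intro t ht
      rw [Nat.mul_add_div hC, Nat.div_eq_of_lt (Finset.mem_range.1 ht)]
      ring
  rw [← key, ← growTime]
  refine Finset.prod_congr rfl fun t ht => ?_
  rw [window, if_pos (Finset.mem_range.1 ht)]

end Window

/-! ### The random choices of the noise in one block -/

/-- The single-edge noise events of a block: the edges of the initial large pair, at time `0`, and
at each time one small pair for each anyon of the large pair (`false` for the left one). -/
abbrev Slot : Type := Fin P.seed ⊕ (Fin P.noiseTime × Bool)

/-- The number of positions from which an event is chosen uniformly. -/
def choices : P.Slot → ℕ := Sum.elim (fun _ => 1) fun ts => P.window ts.1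

/-- The time of an event. -/
def time : P.Slot → ℕ := Sum.elim (fun _ => 0) fun ts => ts.1

/-- The edge of the small pair number `y` for one of the anyons of the large pair at time `t`. -/
def pairEdge (a t : ℤ) (y : ℕ) : Bool → ℤ
  | false => smallEdge (P.left a t) (P.leftDir a t) (P.C + y)
  | true => smallEdge (P.right a t) (P.rightDir a t) (P.C + y)

/-- The edge of an event, relative to the start of the block, for an initial position `m` and
choice `y`. -/
def edge (m : ℕ) (s : P.Slot) (y : ℕ) : ℤ :=
  Sum.elim (fun i : Fin P.seed => P.left (P.shift m) 0 + (i : ℕ))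
    (fun ts => P.pairEdge (P.shift m) (ts.1 : ℕ) y ts.2) s

/-- The events in the initial growth, which betray the initial position. -/
def early : Finset P.Slot := Finset.univ.filter fun s => P.time s < P.growTime

/-- The random choices in a block: the initial position and the positions of the small pairs. -/
abbrev Outcome : Type := Fin P.M × (∀ s : P.Slot, Fin (P.choices s))

section Edge
variable {P}

lemma growTime_pos (hC : 2 ≤ P.C) (hK : 0 < P.K) : 0 < P.growTime := Nat.mul_pos (by omega) hK

lemma nonempty_outcome (hM : 0 < P.M) (hK : 0 < P.K) : Nonempty P.Outcome :=
  ⟨(⟨0, hM⟩, fun s => ⟨0, by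
    rcases s with i | ⟨t, b⟩
    exacts [one_pos, window_pos hK t]⟩)⟩

lemma pairEdge_bounds {a t : ℤ} {y F : ℕ} (hy : P.C + y + 1 ≤ F) (b : Bool) :
    (b = false → P.left a t - F ≤ P.pairEdge a t y b ∧ P.pairEdge a t y b < P.left a t + F) ∧
      (b = true → P.right a t - F ≤ P.pairEdge a t y b ∧
        P.pairEdge a t y b < P.right a t + F) := by
  cases b
  · simp only [pairEdge, smallEdge]
    refine ⟨fun _ => ?_, fun h => by simp at h⟩
    split_ifs <;> omega
  · simp only [pairEdge, smallEdge]
    refine ⟨fun h => by simp at h, fun _ => ?_⟩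
    split_ifs <;> omega

lemma edge_bounds {m : ℕ} (hm : m < P.M) (s : P.Slot) {y : ℕ}
    (hy : y < P.choices s) : 0 ≤ P.edge m s y ∧ P.edge m s y < P.blockLen := by
  have ha := shift_nonneg hm
  have ha' := P.shift_le m
  have hl := P.blockLen_eq
  rcases s with i | ⟨t, b⟩
  · have h1 := reach_le_left (P := P) (t := 0) ha' (by omega)
    have h2 := right_le (P := P) (t := 0) ha (by omega)
    rw [right_zero] at h2
    have := i.2
    simp only [edge, Sum.elim_inl]
    omega
  · have hy' : y < P.window t := hy
    have hw := window_le (t : ℕ) (P := P)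
    have ht : ((t : ℕ) : ℤ) < P.noiseTime := by exact_mod_cast t.2
    have h1 := reach_le_left (P := P) ha' ht.le
    have h2 := right_le (P := P) ha ht.le
    have h3 := seed_add_le (P := P) (a := P.shift m) (t := (t : ℕ))
    have hb := pairEdge_bounds (P := P) (y := y) (F := P.reach)
      (a := P.shift m) (t := (t : ℕ)) (by unfold reach; omega) b
    simp only [edge, Sum.elim_inr]
    cases b
    · have := hb.1 rfl; omega
    · have := hb.2 rfl; omega

/-- For a given initial position, the events are distinct. -/
lemma edge_injective (hC : 2 ≤ P.C) (hK : 0 < P.K) {m : ℕ} (hm : m < P.M) {s s' : P.Slot}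
    {y y' : ℕ} (hy : y < P.choices s) (hy' : y' < P.choices s') (ht : P.time s = P.time s')
    (h : P.edge m s y = P.edge m s' y') : s = s' ∧ y = y' := by
  have ha := shift_nonneg hm
  have ha' := P.shift_le m
  have hB := growTime_pos hC hK
  -- the seed does not meet the small pairs at time `0`
  have hseed : ∀ (i : Fin P.seed) (b : Bool) (y : ℕ),
      P.left (P.shift m) 0 + (i : ℕ) ≠ P.pairEdge (P.shift m) 0 y b := by
    intro i b y
    have hi := i.2
    have hr := right_zero (P := P) (a := P.shift m)
    cases b
    · simp only [pairEdge, smallEdge, leftDir_of_lt (P := P) (t := 0) (by omega)]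
      norm_num
      omega
    · simp only [pairEdge, smallEdge, rightDir_of_lt (P := P) (t := 0) (by omega)]
      norm_num
      omega
  rcases s with i | ⟨t, b⟩ <;> rcases s' with i' | ⟨t', b'⟩
  · simp only [edge, Sum.elim_inl] at h
    have : i = i' := Fin.ext (by omega)
    simp only [choices, Sum.elim_inl] at hy hy'
    exact ⟨by rw [this], by omega⟩
  · have h0 : (t' : ℕ) = 0 := ht.symm
    simp only [edge, Sum.elim_inl, Sum.elim_inr, h0] at h
    exact absurd h (hseed i b' y')
  · have h0 : (t : ℕ) = 0 := ht
    simp only [edge, Sum.elim_inl, Sum.elim_inr, h0] at h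
    exact absurd h.symm (hseed i' b y)
  · obtain rfl : t = t' := Fin.ext ht
    have htn : ((t : ℕ) : ℤ) < P.noiseTime := by exact_mod_cast t.2
    simp only [choices, Sum.elim_inr] at hy hy'
    simp only [edge, Sum.elim_inr] at h
    have h3 := seed_add_le (P := P) (a := P.shift m) (t := (t : ℕ))
    have h4 := mul_window_le (P := P) (by omega) (t : ℕ)
    have h5 : 2 * (P.C + P.window t) < (P.C + 1) * (P.C + P.window t) := by nlinarith
    have hb := pairEdge_bounds (P := P) (y := y) (F := P.C + P.window t) (a := P.shift m)
      (t := (t : ℕ)) (by omega) b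
    have hb' := pairEdge_bounds (P := P) (y := y') (F := P.C + P.window t) (a := P.shift m)
      (t := (t : ℕ)) (by omega) b'
    cases b <;> cases b'
    · refine ⟨rfl, ?_⟩
      simp only [pairEdge, smallEdge] at h
      split_ifs at h <;> omega
    · have := hb.1 rfl; have := hb'.2 rfl; push_cast at *; omega
    · have := hb.2 rfl; have := hb'.1 rfl; push_cast at *; omega
    · refine ⟨rfl, ?_⟩
      simp only [pairEdge, smallEdge] at h
      split_ifs at h <;> omega

/-- An early event is close to the initial position. -/
lemma edge_early_bounds (hC : 0 < P.C) {m : ℕ} {s : P.Slot} (hs : s ∈ P.early) {y : ℕ}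
    (hy : y < P.choices s) : 2 * (m * P.room : ℤ) ≤ P.edge m s y ∧
      P.edge m s y < 2 * (m * P.room : ℤ) + P.room := by
  have hr := P.room_eq
  have hw := P.width_eq
  have hm : (P.half : ℤ) - P.shift m = m * P.room := by unfold shift; ring
  rcases s with i | ⟨t, b⟩
  · have := i.2
    simp only [edge, Sum.elim_inl, left_zero, hm]
    omega
  · have ht : ((t : ℕ) : ℤ) < P.growTime := by
      exact_mod_cast (Finset.mem_filter.1 hs).2
    have hy' : y < P.window t := hy
    have hwin := window_le (t : ℕ) (P := P)
    have hY : P.C + y + 1 ≤ P.reach := by unfold reach; omega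
    simp only [edge, Sum.elim_inr]
    cases b
    · simp only [pairEdge, smallEdge, leftDir_of_lt ht, left_of_lt ht, hm]
      norm_num
      omega
    · simp only [pairEdge, smallEdge, rightDir_of_lt ht, right_of_lt ht, hm]
      norm_num
      omega

/-- An early event determines the initial position. -/
lemma eq_of_edge_early (hC : 0 < P.C) {m m' : ℕ} {s s' : P.Slot}
    (hs : s ∈ P.early) {y y' : ℕ} (hy : y < P.choices s) (hy' : y' < P.choices s')
    (ht : P.time s = P.time s') (h : P.edge m s y = P.edge m' s' y') : m = m' := by
  have h1 := edge_early_bounds hC (m := m) hs hy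
  have hs' : s' ∈ P.early := by
    simp only [early, Finset.mem_filter, Finset.mem_univ, true_and] at hs ⊢
    omega
  have h2 := edge_early_bounds hC (m := m') hs' hy'
  rw [← h] at h2
  have h0 : (0 : ℤ) < P.room := by omega
  by_contra hne
  rcases lt_or_gt_of_ne hne with h' | h'
  · have : ((m : ℤ) + 1) * P.room ≤ m' * P.room :=
      mul_le_mul_of_nonneg_right (by exact_mod_cast h') h0.le
    linarith
  · have : ((m' : ℤ) + 1) * P.room ≤ m * P.room :=
      mul_le_mul_of_nonneg_right (by exact_mod_cast h') h0.le
    linarith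

lemma lt_noiseTime_of_lt_growTime (t : ℕ) (ht : t < P.growTime) : t < P.noiseTime := by
  have := P.noiseTime_eq
  omega

/-- The number of early events and of the choices for them. -/
lemma early_card_and_prod (hC : 0 < P.C) (hK : 0 < P.K) :
    P.early.card = P.seed + 2 * P.growTime ∧
      ∏ s ∈ P.early, P.choices s = (P.K.factorial ^ P.C) ^ 2 := by
  have hset : P.early = Finset.univ.disjSum
      ((Finset.univ.filter fun t : Fin P.noiseTime => (t : ℕ) < P.growTime) ×ˢ Finset.univ) := by
    ext s
    have hB : 0 < P.growTime := Nat.mul_pos hC hK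
    rcases s with i | ⟨t, b⟩ <;> simp only [early, Finset.mem_filter] <;> simp [time, hB]
  have hmap : (Finset.univ.filter fun t : Fin P.noiseTime => (t : ℕ) < P.growTime).map
      Fin.valEmbedding = Finset.range P.growTime := by
    ext t
    simp only [Finset.mem_map, Finset.mem_filter, Finset.mem_univ, true_and,
      Fin.valEmbedding_apply, Finset.mem_range]
    constructor
    · rintro ⟨t, ht, rfl⟩; exact ht
    · intro ht; exact ⟨⟨t, lt_noiseTime_of_lt_growTime t ht⟩, ht, rfl⟩
  constructor
  · rw [hset, Finset.card_disjSum, Finset.card_product, Finset.card_univ, Finset.card_univ,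
      ← Finset.card_map (s := Finset.univ.filter _) Fin.valEmbedding, hmap]
    simp [mul_comm]
  · rw [hset, Finset.prod_disjSum, Finset.prod_product]
    simp only [choices, Sum.elim_inl, Sum.elim_inr, Finset.prod_const_one, one_mul,
      Finset.prod_const, Finset.card_univ, Fintype.card_bool]
    rw [Finset.prod_pow, ← prod_window hC, ← hmap, Finset.prod_map]
    rfl

end Edge

end Design

/-! ### The noise model -/

namespace Design
variable (P : Design) {d : ℕ} (i₀ : Fin d) (L n : ℕ)

/-- The noise in block `k`. -/
def blockNoise (k : ZMod n) : P.Outcome → Set (Edge d L × ℕ) :=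
  slotSet fun (m : Fin P.M) s (y : Fin (P.choices s)) =>
    (lineEdge i₀ ((blockStart L n k.val + P.edge m s y : ℤ) : ZMod L), P.time s)

/-- The noise realization for given random choices in all blocks. -/
def noise (ω : ZMod n → P.Outcome) : Noise d L := {z | ∃ k, z ∈ P.blockNoise i₀ L n k (ω k)}

variable {P L n}

section Probability

lemma mem_Ico_val [NeZero n] (k : ZMod n) : (k.val : ℤ) ∈ Finset.Ico (0 : ℤ) n := by
  have := k.val_lt
  rw [Finset.mem_Ico]
  omega

/-- The edges of different blocks are different. -/
lemma eq_of_edge_eq (hl : P.blockLen * n ≤ L) {k k' : ℤ}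
    (hk : k ∈ Finset.Ico (0 : ℤ) n) (hk' : k' ∈ Finset.Ico (0 : ℤ) n) {m m' : ℕ}
    (hm : m < P.M) (hm' : m' < P.M) {s s' : P.Slot} {y y' : ℕ} (hy : y < P.choices s)
    (hy' : y' < P.choices s')
    (h : ((blockStart L n k + P.edge m s y : ℤ) : ZMod L) =
      ((blockStart L n k' + P.edge m' s' y' : ℤ) : ZMod L)) :
    k = k' ∧ P.edge m s y = P.edge m' s' y' := by
  have hn : 0 < n := by
    rw [Finset.mem_Ico] at hk
    omega
  have h1 := edge_bounds hm s hy
  have h2 := edge_bounds hm' s' hy'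
  have h3 := blockStart_add_le hn hl k
  have h4 := blockStart_add_le hn hl k'
  obtain ⟨rfl, h5⟩ := eq_of_cast_eq_of_mem_blocks (s₀ := 0) hn hk hk' (by omega) (by omega)
    (by omega) (by omega) h
  exact ⟨rfl, by omega⟩

lemma eq_of_mem_blockNoise [NeZero n] (hl : P.blockLen * n ≤ L) {k k' : ZMod n}
    {ω ω' : P.Outcome} {z : Edge d L × ℕ} (h : z ∈ P.blockNoise i₀ L n k ω)
    (h' : z ∈ P.blockNoise i₀ L n k' ω') : k = k' := by
  obtain ⟨s, rfl⟩ := h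
  obtain ⟨s', hs'⟩ := h'
  have := (eq_of_edge_eq hl (mem_Ico_val k') (mem_Ico_val k) ω'.1.2 ω.1.2 (ω'.2 s').2 (ω.2 s).2
    (lineEdge_injective i₀ (congrArg Prod.fst hs'))).1
  exact ZMod.val_injective n (by exact_mod_cast this.symm)

/-- The uniform distribution is taken on the discrete measurable space. -/
instance : MeasurableSpace P.Outcome := ⊤

instance : MeasurableSingletonClass P.Outcome := ⟨fun _ => trivial⟩

lemma pBounded_noise [NeZero n] (hl : P.blockLen * n ≤ L) (hC : 2 ≤ P.C) (hK : 0 < P.K)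
    (hM : P.K ^ (P.seed + 2 * P.growTime) ≤ P.M * (P.K.factorial ^ P.C) ^ 2) {p : ℝ}
    (hp : 1 / (P.K : ℝ) < p) : PBounded p (blockMeasure (P.blockNoise i₀ L n)) := by
  classical
  let Z : Edge d L × ℕ → ZMod n := fun z =>
    if h : ∃ k ω, z ∈ P.blockNoise i₀ L n k ω then h.choose else 0
  refine pBounded_blockMeasure _ Z (fun k ω z hz => ?_) hK hp fun k A => ?_
  · have h : ∃ k ω, z ∈ P.blockNoise i₀ L n k ω := ⟨k, ω, hz⟩
    obtain ⟨ω', h'⟩ := h.choose_spec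
    simp only [Z, dif_pos h]
    exact eq_of_mem_blockNoise i₀ hl h' hz
  · obtain ⟨hcard, hprod⟩ := early_card_and_prod (P := P) (by omega) hK
    refine card_subset_slotSet_mul_le (fun (m : Fin P.M) s (y : Fin (P.choices s)) =>
      (lineEdge i₀ ((blockStart L n k.val + P.edge m s y : ℤ) : ZMod L), P.time s)) P.K P.early
      ?_ ?_ ?_ ?_ ?_ A
    · intro m s y s' y' h
      have h1 := (eq_of_edge_eq hl (mem_Ico_val k) (mem_Ico_val k) m.2 m.2 y.2 y'.2
        (lineEdge_injective i₀ (congrArg Prod.fst h))).2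
      obtain ⟨rfl, h2⟩ := edge_injective hC hK m.2 y.2 y'.2 (congrArg Prod.snd h) h1
      rw [Fin.ext h2]
    · intro m s hs y m' s' y' h
      have h1 := (eq_of_edge_eq hl (mem_Ico_val k) (mem_Ico_val k) m.2 m'.2 y.2 y'.2
        (lineEdge_injective i₀ (congrArg Prod.fst h))).2
      exact Fin.ext (eq_of_edge_early (by omega) hs y.2 y'.2 (congrArg Prod.snd h) h1)
    · intro s _
      rcases s with i | ⟨t, b⟩
      · exact hK
      · exact window_le t
    · intro s hs
      simp only [early, Finset.mem_filter, Finset.mem_univ, true_and, not_lt] at hs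
      rcases s with i | ⟨t, b⟩
      · have h0 : P.growTime ≤ 0 := hs
        have := growTime_pos hC hK
        omega
      · have ht : P.growTime ≤ t := hs
        simp only [choices, Sum.elim_inr, window]
        rw [if_neg (by omega)]
    · rw [hcard, hprod, Fintype.card_fin]
      exact hM

lemma natAbs_valMinAbs_intCast_le [NeZero L] (D : ℤ) :
    (D : ZMod L).valMinAbs.natAbs ≤ D.natAbs := by
  have h1 := ZMod.natAbs_valMinAbs_le (D : ZMod L)
  by_cases h : D.natAbs ≤ L / 2
  · rcases Int.natAbs_eq D with h' | h'
    · rw [h', Int.cast_natCast, ZMod.valMinAbs_natCast_of_le_half h]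
    · rw [h', Int.cast_neg, Int.cast_natCast, ZMod.natAbs_valMinAbs_neg,
        ZMod.valMinAbs_natCast_of_le_half h]
      simp
  · omega

lemma localRange_noise [NeZero L] [NeZero n] (hM : 0 < P.M)
    (hK : 0 < P.K) : LocalRange P.blockLen (blockMeasure (P.blockNoise i₀ L n)) := by
  intro A B hAB
  have := nonempty_outcome hM hK
  refine indepFun_blockMeasure (P.blockNoise i₀ L n) {z | z.1 ∈ A} {z | z.1 ∈ B} ?_
  rintro k ω ω' _ _ ⟨s, rfl⟩ hA ⟨s', rfl⟩ hB
  refine absurd (hAB _ hA _ hB) (not_lt.2 (Finset.sup_le fun i _ => ?_))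
  have h1 := edge_bounds ω.1.2 s (ω.2 s).2
  have h2 := edge_bounds ω'.1.2 s' (ω'.2 s').2
  by_cases hi : i = i₀
  · subst hi
    simp only [lineEdge, lineSite_apply_self]
    rw [← Int.cast_sub]
    refine (natAbs_valMinAbs_intCast_le _).trans ?_
    omega
  · simp [lineEdge, lineSite, hi]

end Probability

/-! ### The dynamics under the noise -/

section Dynamics
variable (ω : ZMod n → P.Outcome)

/-- The left anyon of the large pair of block `k` at time `t`. -/
def leftAt (t k : ℤ) : ℤ := blockStart L n k + P.left (P.shift (ω k).1) t

/-- The right anyon of the large pair of block `k` at time `t`. -/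
def rightAt (t k : ℤ) : ℤ := blockStart L n k + P.right (P.shift (ω k).1) t

lemma smallEdge_add (b z s y : ℤ) : smallEdge (b + z) s y = b + smallEdge z s y := by
  unfold smallEdge
  split_ifs <;> ring

lemma chainOf_noise_eq_sum [NeZero n] (hl : P.blockLen * n ≤ L) (hC : 2 ≤ P.C) (hK : 0 < P.K)
    (t : ℕ) :
    chainOf {e | (e, t) ∈ P.noise i₀ L n ω} = lineChain i₀ (∑ k ∈ Finset.Ico (0 : ℤ) n,
      ∑ s : P.Slot, if P.time s = t then
        ringPoint L (blockStart L n k + P.edge (ω k).1 s ((ω k).2 s)) else 0) := by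
  classical
  let T := Finset.Ico (0 : ℤ) n ×ˢ Finset.univ.filter fun s : P.Slot => P.time s = t
  let c : ℤ × P.Slot → ℤ := fun ks =>
    blockStart L n ks.1 + P.edge (ω ks.1).1 ks.2 ((ω ks.1).2 ks.2)
  have hset : {e | (e, t) ∈ P.noise i₀ L n ω} =
      {e | ∃ z ∈ {z : ZMod L | ∃ ks ∈ T, (c ks : ZMod L) = z}, lineEdge i₀ z = e} := by
    ext e
    constructor
    · rintro ⟨k, s, hs⟩
      have h1 : lineEdge i₀ _ = e := congrArg Prod.fst hs
      refine ⟨_, ⟨(k.val, s), ?_, rfl⟩, ?_⟩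
      · exact Finset.mem_product.2 ⟨mem_Ico_val k, Finset.mem_filter.2
          ⟨Finset.mem_univ _, congrArg Prod.snd hs⟩⟩
      · refine Eq.trans ?_ h1
        simp only [c, Int.cast_natCast, ZMod.natCast_zmod_val]
    · rintro ⟨_, ⟨⟨k, s⟩, hks, rfl⟩, rfl⟩
      obtain ⟨hk, hs⟩ := Finset.mem_product.1 hks
      refine ⟨(k : ZMod n), s, Prod.ext ?_ (Finset.mem_filter.1 hs).2⟩
      have : ((k : ZMod n).val : ℤ) = k := by
        rw [Finset.mem_Ico] at hk
        rw [ZMod.val_intCast, Int.emod_eq_of_lt hk.1 hk.2]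
      simp only [c, this]
  rw [hset, chainOf_lineEdge]
  have hinj : ∀ i ∈ T, ∀ j ∈ T, (c i : ZMod L) = c j → i = j := by
    rintro ⟨k, s⟩ h1 ⟨k', s'⟩ h2 h
    obtain ⟨hk, hs⟩ := Finset.mem_product.1 h1
    obtain ⟨hk', hs'⟩ := Finset.mem_product.1 h2
    obtain ⟨rfl, he⟩ := eq_of_edge_eq hl hk hk' (ω k).1.2 (ω k').1.2 ((ω k).2 s).2
      ((ω k').2 s').2 h
    have := (edge_injective hC hK (ω k).1.2 ((ω k).2 s).2 ((ω k).2 s').2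
      ((Finset.mem_filter.1 hs).2.trans (Finset.mem_filter.1 hs').2.symm) he).1
    rw [this]
  have hind := indicator_eq_sum_ringPoint T c hinj
  rw [Finset.sum_product] at hind
  simp only [T, Finset.sum_filter] at hind
  rw [← hind]
  congr 1
  ext z
  simp only [Set.mem_ofPred_eq, T]
  split_ifs <;> rfl

lemma segment_eq_sum_fin (u : ℤ) (m : ℕ) :
    ∑ i : Fin m, ringPoint L (u + (i : ℕ)) = segment L u (u + m) := by
  induction m with
  | zero => simp [segment]
  | succ m ih =>
    rw [Fin.sum_univ_castSucc]
    simp only [Fin.val_castSucc, Fin.val_last]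
    rw [ih, Nat.cast_succ, ← add_assoc, segment_succ_right (by omega)]

/-- The number of the small pair chosen at time `t` for the left (`false`) or right (`true`) anyon
of the large pair of block `k`. -/
def choiceAt (t : Fin P.noiseTime) (b : Bool) (k : ℤ) : ℤ := P.C + ((ω k).2 (Sum.inr (t, b)) : ℕ)

/-- The noise at time `t` adds a small pair next to each anyon of each large pair, and at time `0`
it also creates the large pairs. -/
lemma chainOf_noise [NeZero n] (hl : P.blockLen * n ≤ L) (hC : 2 ≤ P.C) (hK : 0 < P.K)
    (t : Fin P.noiseTime) :
    chainOf {e | (e, (t : ℕ)) ∈ P.noise i₀ L n ω} = lineChain i₀ (∑ k ∈ Finset.Ico (0 : ℤ) n,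
      ((if (t : ℕ) = 0 then segment L (leftAt (L := L) ω 0 k) (rightAt (L := L) ω 0 k) else 0) +
      (ringPoint L (smallEdge (leftAt (L := L) ω (t : ℕ) k)
          (P.leftDir (P.shift (ω k).1) (t : ℕ)) (choiceAt ω t false k)) +
        ringPoint L (smallEdge (rightAt (L := L) ω (t : ℕ) k)
          (P.rightDir (P.shift (ω k).1) (t : ℕ)) (choiceAt ω t true k))))) := by
  rw [chainOf_noise_eq_sum i₀ ω hl hC hK]
  congr 1
  refine Finset.sum_congr rfl fun k _ => ?_
  rw [Fintype.sum_sum_type, Fintype.sum_prod_type]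
  congr 1
  · simp only [time, Sum.elim_inl, edge]
    by_cases h : (t : ℕ) = 0
    · simp only [h, if_true]
      have h2 : rightAt (L := L) ω 0 k = leftAt (L := L) ω 0 k + P.seed := by
        rw [rightAt, leftAt, right_zero]; ring
      rw [h2, ← segment_eq_sum_fin]
      refine Finset.sum_congr rfl fun i _ => ?_
      rw [leftAt, add_assoc]
    · have h' : ¬ (0 = (t : ℕ)) := fun h0 => h h0.symm
      simp [h, h']
  · rw [Finset.sum_eq_single t]
    · simp only [time, Sum.elim_inr, if_true, edge, Fintype.sum_bool, pairEdge, leftAt, rightAt,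
        smallEdge_add, choiceAt]
      rw [add_comm]
    · intro t' _ ht'
      have : ¬ ((t' : ℕ) = t) := fun h => ht' (Fin.ext h)
      simp [time, this]
    · simp

/-- As long as the noise acts, all large pairs follow the schedule. -/
lemma state_succ_eq [NeZero L] [NeZero n] {α : ℝ} (hα : 0 < α)
    {φ : EuclideanSpace ℝ (Fin d) → Dir d} (hφ : RespectsAxes φ) (hn : 10 ≤ n)
    (hl : P.blockLen * n ≤ L) (hCα : 60 * (P.C : ℝ) ^ (-α) < 1) (hC : 2 ≤ P.C) (hK : 0 < P.K)
    (t : ℕ) (ht : t < P.noiseTime) :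
    state α φ (P.noise i₀ L n ω) (t + 1) = lineChain i₀ (∑ k ∈ Finset.Ico (0 : ℤ) n,
      segment L (leftAt (L := L) ω (t + 1 : ℕ) k) (rightAt (L := L) ω (t + 1 : ℕ) k)) := by
  have hpre : state α φ (P.noise i₀ L n ω) t + chainOf {e | (e, t) ∈ P.noise i₀ L n ω} =
      lineChain i₀ (∑ k ∈ Finset.Ico (0 : ℤ) n,
        (segment L (leftAt (L := L) ω t k) (rightAt (L := L) ω t k) +
        (ringPoint L (smallEdge (leftAt (L := L) ω t k)
          (P.leftDir (P.shift (ω k).1) t) (choiceAt ω ⟨t, ht⟩ false k)) +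
        ringPoint L (smallEdge (rightAt (L := L) ω t k)
          (P.rightDir (P.shift (ω k).1) t) (choiceAt ω ⟨t, ht⟩ true k))))) := by
    have hN := chainOf_noise i₀ ω hl hC hK ⟨t, ht⟩
    simp only at hN
    rw [hN]
    rcases Nat.eq_zero_or_pos t with rfl | h0
    · rw [state, zero_add]
      simp only [if_true, Nat.cast_zero]
    · obtain ⟨t, rfl⟩ : ∃ t', t = t' + 1 := ⟨t - 1, by omega⟩
      rw [state_succ_eq hα hφ hn hl hCα hC hK t (by omega), ← lineChain_add,
        ← Finset.sum_add_distrib]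
      simp only [Nat.succ_ne_zero, if_false, zero_add]
  rw [state, hpre]
  have hYK := P.blockLen_eq
  have hwin := window_le (P := P) t
  have ht' : (t : ℤ) < P.noiseTime := by exact_mod_cast ht
  have hC1 : (P.C : ℤ) * (P.C + P.window t : ℕ) ≤ P.C * P.reach :=
    mul_le_mul_of_nonneg_left (by unfold reach; omega) (by omega)
  have hmargin : (P.margin : ℤ) = 2 * (P.C * P.reach) + 1 := by unfold margin; push_cast; ring
  have hCR : (0 : ℤ) ≤ P.C * P.reach := by positivity
  have hreach : P.C + P.window t ≤ P.reach := by unfold reach; omega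
  have hω : ∀ k : ℤ, 0 ≤ P.shift (ω k).1 ∧ P.shift (ω k).1 ≤ P.half := fun k =>
    ⟨shift_nonneg (ω k).1.2, P.shift_le _⟩
  have hωn : ∀ k : ℤ, ω ((k + n : ℤ) : ZMod n) = ω k := fun k => by
    congr 1; push_cast; simp
  have hch : ∀ b k, (P.C : ℤ) ≤ choiceAt ω ⟨t, ht⟩ b k ∧
      choiceAt ω ⟨t, ht⟩ b k + 1 ≤ (P.C + P.window t : ℕ) := by
    intro b k
    have h1 : (((ω k).2 (Sum.inr (⟨t, ht⟩, b)) : ℕ)) < P.window t :=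
      ((ω k).2 (Sum.inr (⟨t, ht⟩, b))).2
    unfold choiceAt
    push_cast
    omega
  have hstep := pair_step i₀ hα hφ hn hl (C := P.C) (F := (P.C + P.window t : ℕ)) (Δ := P.margin)
    (by exact_mod_cast hCα) (by omega) (by omega) (by omega)
    (leftAt (L := L) ω t) (rightAt (L := L) ω t) (fun k => P.leftDir (P.shift (ω k).1) t)
    (fun k => P.rightDir (P.shift (ω k).1) t) (choiceAt ω ⟨t, ht⟩ false)
    (choiceAt ω ⟨t, ht⟩ true)
    (fun k => by
      refine ⟨?_, ?_, ?_, ?_, ?_, ?_⟩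
      · rw [leftAt, leftAt, hωn, blockStart_add_period (by omega)]; ring
      · rw [rightAt, rightAt, hωn, blockStart_add_period (by omega)]; ring
      · rw [hωn]
      · rw [hωn]
      · rw [choiceAt, choiceAt, hωn]
      · rw [choiceAt, choiceAt, hωn])
    (fun k => leftDir_eq (hω k).1 (hω k).2 ht') (fun k => rightDir_eq (hω k).1 (hω k).2 ht')
    (fun k => (hch false k).1) (fun k => (hch false k).2) (fun k => (hch true k).1)
    (fun k => (hch true k).2)
    (fun k => by
      have h1 := seed_add_le (P := P) (a := P.shift (ω k).1) (t := t)
      have h2 : (((P.C + 1) * (P.C + P.window t) : ℕ) : ℤ) ≤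
          ((P.seed + 2 * min t P.growTime : ℕ) : ℤ) := by
        exact_mod_cast mul_window_le (P := P) (by omega) t
      unfold leftAt rightAt
      push_cast at h2 ⊢
      linarith)
    (fun k => by
      have := reach_le_left (hω k).2 ht'.le
      unfold leftAt
      omega)
    (fun k => by
      have h1 := right_le (hω k).1 ht'.le
      have h2 := blockStart_add_le (L := L) (n := n) (by omega) hl k
      unfold rightAt
      omega)
  rw [hstep]
  congr 1
  refine Finset.sum_congr rfl fun k _ => ?_
  rw [leftAt, leftAt, rightAt, rightAt, add_assoc, add_assoc, left_add_leftDir,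
    right_add_rightDir]
  push_cast
  rfl

/-- After the noise has stopped, all gaps close at the same time. -/
lemma state_noiseTime_add [NeZero L] [NeZero n] {α : ℝ} (hα : 0 < α)
    {φ : EuclideanSpace ℝ (Fin d) → Dir d} (hφ : RespectsAxes φ) (hn : 10 ≤ n)
    (hl : P.blockLen * n ≤ L) (hL : L ≤ (P.blockLen + 1) * n)
    (hCα : 60 * (P.C : ℝ) ^ (-α) < 1) (hC : 2 ≤ P.C) (hK : 0 < P.K)
    (hM : (P.C + 1) ^ 2 + 1 ≤ P.M) (s : ℕ) (hs : s ≤ P.closeTime) :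
    state α φ (P.noise i₀ L n ω) (P.noiseTime + s) = lineChain i₀
      (1 + ∑ k ∈ Finset.Ico (0 : ℤ) n, segment L
        (blockStart L n k + P.reach + 4 * P.half + P.width + s)
        (blockStart L n (k + 1) + P.reach - s)) := by
  have hn0 : 0 < n := by omega
  have hYK := P.blockLen_eq
  have hroom := P.room_eq
  have hmargin : (P.margin : ℤ) = 2 * (P.C * P.reach) + 1 := by unfold margin; push_cast; ring
  have hclose : (P.closeTime : ℤ) = P.C * P.reach + P.reach + 1 := by
    unfold closeTime; push_cast; ring
  have hreach : 0 < P.reach := by unfold reach; omega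
  have hB : 0 < P.noiseTime := by
    have h1 := P.noiseTime_eq
    have h2 := growTime_pos hC hK
    omega
  -- the large pairs are much longer than the gaps
  have hlong : (P.C : ℤ) * (2 * P.closeTime) ≤ 4 * P.half := by
    have h1 : (P.C + 1) ^ 2 * (2 * P.reach) ≤ P.half :=
      Nat.mul_le_mul (by omega) (by omega)
    have h2 : P.C * (2 * P.closeTime) ≤ 4 * P.half := by
      unfold closeTime
      nlinarith
    exact_mod_cast h2
  induction s with
  | zero =>
    obtain ⟨t, ht⟩ : ∃ t, P.noiseTime = t + 1 := ⟨P.noiseTime - 1, by omega⟩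
    have hω : ∀ k : ℤ, 0 ≤ P.shift (ω k).1 ∧ P.shift (ω k).1 ≤ P.half := fun k =>
      ⟨shift_nonneg (ω k).1.2, P.shift_le _⟩
    have h1 := state_succ_eq i₀ ω hα hφ hn hl hCα hC hK t (by omega)
    rw [← ht] at h1
    rw [add_zero, h1]
    have h2 : ∀ k : ℤ, leftAt (L := L) ω P.noiseTime k = blockStart L n k + P.reach := fun k => by
      rw [leftAt, left_noiseTime (hω k).1 (hω k).2]
    have h3 : ∀ k : ℤ, rightAt (L := L) ω P.noiseTime k =
        blockStart L n k + P.reach + 4 * P.half + P.width := fun k => by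
      rw [rightAt, right_noiseTime (hω k).1 (hω k).2]; ring
    simp only [h2, h3]
    rw [sum_segment_eq_one_add (fun k => blockStart L n k + P.reach)
      (fun k => blockStart L n k + P.reach + 4 * P.half + P.width)]
    · simp
    · intro k
      rw [blockStart_add_period hn0]; ring
    · intro k
      omega
    · intro k
      have := blockStart_add_le hn0 hl k
      omega
  | succ s ih =>
    have hnone : {e | (e, P.noiseTime + s) ∈ P.noise i₀ L n ω} = ∅ := by
      refine Set.eq_empty_of_forall_notMem ?_
      rintro e ⟨k, sl, h⟩
      have h1 : P.time sl = P.noiseTime + s := congrArg Prod.snd h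
      rcases sl with i | ⟨t, b⟩
      · have : 0 = P.noiseTime + s := h1
        omega
      · have : (t : ℕ) = P.noiseTime + s := h1
        omega
    rw [← add_assoc, state, hnone, chainOf_empty, add_zero, ih (by omega)]
    have hstep := closing_step i₀ hα hφ hn hl (C := P.C) (F := 2 * P.closeTime)
      (s₀ := P.reach + 4 * P.half + P.width) (Δ := 4 * P.half + P.width)
      (by exact_mod_cast hCα) (by omega) (by omega) (by omega)
      (fun k => blockStart L n k + P.reach + 4 * P.half + P.width + s)
      (fun k => blockStart L n (k + 1) + P.reach - s)
      (fun k => by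
        rw [show k + n + 1 = k + 1 + n by ring, blockStart_add_period hn0,
          blockStart_add_period hn0]
        constructor <;> ring)
      (fun k => by
        have := blockStart_add_le hn0 hl k
        omega)
      (fun k => by
        have := blockStart_le_add hn0 hL k
        omega)
      (fun k => by omega)
      (fun k => by omega)
    rw [hstep]
    congr 2
    refine Finset.sum_congr rfl fun k _ => ?_
    push_cast
    congr 1 <;> ring

/-- The noise and the decoder together flip all qubits on a line. -/
lemma state_final [NeZero L] [NeZero n] {α : ℝ} (hα : 0 < α)
    {φ : EuclideanSpace ℝ (Fin d) → Dir d} (hφ : RespectsAxes φ) (hn : 10 ≤ n)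
    (hl : P.blockLen * n ≤ L) (hL : L ≤ (P.blockLen + 1) * n)
    (hCα : 60 * (P.C : ℝ) ^ (-α) < 1) (hC : 2 ≤ P.C) (hK : 0 < P.K)
    (hM : (P.C + 1) ^ 2 + 1 ≤ P.M) :
    state α φ (P.noise i₀ L n ω) (P.noiseTime + P.closeTime) = lineChain i₀ 1 := by
  rw [state_noiseTime_add i₀ ω hα hφ hn hl hL hCα hC hK hM _ le_rfl]
  congr 1
  rw [add_eq_left]
  refine Finset.sum_eq_zero fun k _ => ?_
  have := blockStart_le_add (L := L) (n := n) (by omega) hL k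
  have hYK := P.blockLen_eq
  have hmargin : (P.margin : ℤ) = 2 * (P.C * P.reach) + 1 := by unfold margin; push_cast; ring
  have hclose : (P.closeTime : ℤ) = P.C * P.reach + P.reach + 1 := by
    unfold closeTime; push_cast; ring
  rw [segment, Finset.Ico_eq_empty (by omega), Finset.sum_empty]

end Dynamics

end Design

/-! ### Memory time -/

section Memory
variable {d L : ℕ}

lemma syndrome_zero : syndrome (0 : Chain d L) = 0 := by
  ext v
  simp [syndrome]

variable [NeZero L]

lemma syndrome_lineChain_one (i₀ : Fin d) : syndrome (lineChain (L := L) i₀ 1) = 0 := by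
  ext v
  by_cases h : ∃ z, lineSite i₀ z = v
  · obtain ⟨z, rfl⟩ := h
    rw [syndrome_lineChain_lineSite]
    simp [ringBoundary, CharTwo.add_self_eq_zero]
  · push Not at h
    rw [syndrome_lineChain_eq_zero i₀ 1 h, Pi.zero_apply]

/-- A decoder that handles the trivial syndrome correctly turns an error along a full lattice line
into a logical error. -/
lemma residual_lineChain_one_ne_zero (i₀ : Fin d) (D : (Site d L → ZMod 2) → Chain d L)
    (hD : residual D 0 = 0) : residual D (lineChain i₀ 1) ≠ 0 := by
  intro h
  rw [residual, syndrome_zero, zero_add] at hD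
  rw [residual, syndrome_lineChain_one, winding_add, hD, add_zero] at h
  have := congrFun h i₀
  rw [winding_lineChain] at this
  simp at this

/-- A logical error that is almost sure at time `T` limits the memory time to `T`: the distance from
any logical basis state is then at least `1`. -/
lemma memoryTime_le {α : ℝ} {φ : EuclideanSpace ℝ (Fin d) → Dir d}
    {D : (Site d L → ZMod 2) → Chain d L} {μ : Measure (Noise d L)} {T : ℕ}
    (h : μ {N | residual D (state α φ N T) = 0} = 0) : memoryTime α φ D μ ≤ T := by
  refine iSup_le fun k => iInf₂_le_of_le T ?_ le_rfl
  have h0 : μ.real {N | k + residual D (state α φ N T) = k} = 0 := by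
    simp only [add_eq_left, measureReal_def, h, ENNReal.toReal_zero]
  have h1 : |μ.real {N | k + residual D (state α φ N T) = k} - if k = k then 1 else 0| ≤
      logicalDist α φ D μ k T := by
    unfold logicalDist
    exact Finset.single_le_sum (f := fun h : Fin d → ZMod 2 =>
      |μ.real {N | k + residual D (state α φ N T) = h} - if h = k then 1 else 0|)
      (fun _ _ => abs_nonneg _) (Finset.mem_univ k)
  rw [h0, if_pos rfl] at h1
  norm_num at h1
  rw [Set.mem_ofPred_eq]
  linarith

end Memory

section Empty
variable {ι : Type*} [Countable ι]

lemma dirac_empty_apply (E : Set (Set ι)) [Decidable (∅ ∈ E)] :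
    (Measure.dirac ∅ : Measure (Set ι)) E = if ∅ ∈ E then 1 else 0 := by
  have : MeasurableSingletonClass (Set ι) :=
    inferInstanceAs (MeasurableSingletonClass (ι → Prop))
  rw [Measure.dirac_apply, Set.indicator_apply]
  rfl

lemma pBounded_dirac_empty {p : ℝ} (hp : 0 < p) : PBounded p (Measure.dirac (∅ : Set ι)) := by
  classical
  intro A hA
  rw [dirac_empty_apply, if_neg]
  · exact ENNReal.pow_pos (ENNReal.ofReal_pos.2 hp) _
  · simpa [Set.subset_empty_iff] using hA.ne_empty

lemma localRange_dirac_empty {d L : ℕ} (l : ℕ) [NeZero L] :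
    LocalRange l (Measure.dirac (∅ : Noise d L)) := by
  classical
  intro A B _
  rw [indepFun_iff_measure_inter_preimage_eq_mul]
  intro s t _ _
  rw [dirac_empty_apply, dirac_empty_apply, dirac_empty_apply]
  by_cases h1 : (∅ : Noise d L) ∈ (fun N : Noise d L => ({z ∈ N | z.1 ∈ A} : Noise d L)) ⁻¹' s <;>
    by_cases h2 : (∅ : Noise d L) ∈ (fun N : Noise d L => ({z ∈ N | z.1 ∈ B} : Noise d L)) ⁻¹' t <;>
    simp only [Set.mem_inter_iff, h1, h2] <;> simp

end Empty

/-- A decoder with a threshold handles the trivial syndrome correctly on all large lattices. -/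
lemma eventually_residual_zero {d : ℕ} {D : ∀ L : ℕ+, (Site d L → ZMod 2) → Chain d L}
    (hD : HasThreshold D) : ∀ᶠ L in atTop, residual (D L) 0 = 0 := by
  classical
  obtain ⟨pc, hpc, h⟩ := hD
  have h1 := h (pc / 2) (by linarith) (by linarith) (fun _ => Measure.dirac ∅)
    (fun _ => inferInstance) (fun _ => pBounded_dirac_empty (by linarith))
  filter_upwards [h1.eventually_lt_const (u := 1) (by simp)] with L hL
  by_contra hne
  rw [dirac_empty_apply, if_pos] at hL
  · exact lt_irrefl _ hL
  · rw [Set.mem_ofPred_eq, chainOf_empty]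
    exact hne

/-- For a suitable design, there is a local bounded noise model that flips all qubits on a line of
every sufficiently large lattice, at a time that does not depend on the size of the lattice. -/
lemma exists_noise {d : ℕ} (i₀ : Fin d) {α : ℝ} (hα : 0 < α)
    {φ : EuclideanSpace ℝ (Fin d) → Dir d} (hφ : RespectsAxes φ) (P : Design)
    (hCα : 60 * (P.C : ℝ) ^ (-α) < 1) (hC : 2 ≤ P.C) (hK : 0 < P.K)
    (hM : (P.C + 1) ^ 2 + 1 ≤ P.M)
    (hM' : P.K ^ (P.seed + 2 * P.growTime) ≤ P.M * (P.K.factorial ^ P.C) ^ 2) {p : ℝ}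
    (hp : 1 / (P.K : ℝ) < p) (L : ℕ) [NeZero L] :
    ∃ μ : Measure (Noise d L), IsProbabilityMeasure μ ∧ PBounded p μ ∧
      LocalRange P.blockLen μ ∧ (10 * P.blockLen ≤ L → P.blockLen * P.blockLen ≤ L →
        μ {N | state α φ N (P.noiseTime + P.closeTime) ≠ lineChain i₀ 1} = 0) := by
  have hl : 0 < P.blockLen := by
    have := P.blockLen_eq
    unfold Design.margin at this
    omega
  by_cases hL : P.blockLen ≤ L
  · have hn : 0 < L / P.blockLen := Nat.div_pos hL hl
    have : NeZero (L / P.blockLen) := ⟨hn.ne'⟩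
    have hlL : P.blockLen * (L / P.blockLen) ≤ L := Nat.mul_div_le _ _
    have hne : Nonempty P.Outcome := Design.nonempty_outcome (by omega) hK
    refine ⟨blockMeasure (P.blockNoise i₀ L (L / P.blockLen)), inferInstance,
      Design.pBounded_noise i₀ hlL hC hK hM' hp, Design.localRange_noise i₀ (by omega) hK,
      fun h10 hsq => blockMeasure_eq_zero _ _ fun ω => ?_⟩
    have hn10 : 10 ≤ L / P.blockLen := (Nat.le_div_iff_mul_le hl).2 h10
    have hnl : P.blockLen ≤ L / P.blockLen := (Nat.le_div_iff_mul_le hl).2 hsq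
    have hlL' : L ≤ (P.blockLen + 1) * (L / P.blockLen) := by
      have h1 := Nat.div_add_mod L P.blockLen
      have h2 := Nat.mod_lt L hl
      rw [add_mul, one_mul]
      omega
    simp only [Set.mem_ofPred_eq, ne_eq, not_not]
    exact Design.state_final i₀ ω hα hφ hn10 hlL hlL' hCα hC hK hM
  · -- lattices that are smaller than a block remain without noise
    refine ⟨Measure.dirac ∅, inferInstance, pBounded_dirac_empty (lt_of_le_of_lt ?_ hp),
      localRange_dirac_empty _, fun h10 _ => ?_⟩
    · positivity
    · omega

/-! ### Choice of the parameters -/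

/-- Because of this the number of initial positions that make up for the missing choices in the
initial growth is only exponential in `K`, without a logarithmic correction to the exponent. -/
lemma pow_self_le_four_pow_mul_factorial (K : ℕ) : K ^ K ≤ 4 ^ K * K.factorial := by
  have h1 := Real.pow_div_factorial_le_exp (K : ℝ) (Nat.cast_nonneg K) K
  have h2 : Real.exp K ≤ 4 ^ K := by
    rw [← mul_one (K : ℝ), Real.exp_nat_mul]
    exact pow_le_pow_left₀ (Real.exp_pos 1).le (by linarith [Real.exp_one_lt_three]) K
  have h3 : (0 : ℝ) < K.factorial := by exact_mod_cast K.factorial_pos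
  rw [div_le_iff₀ h3] at h1
  have h4 : (K : ℝ) ^ K ≤ 4 ^ K * K.factorial := h1.trans (mul_le_mul_of_nonneg_right h2 h3.le)
  exact_mod_cast h4

/-- The noise design with small pairs at one of up to `K` positions, and as many initial positions as
`designOf_entropy` requires. -/
def designOf (C K : ℕ) : Design := ⟨C, K, 2 ^ (K * ((C + 1) ^ 2 + 4 * C))⟩

/-- The number of initial positions makes up for the missing choices in the initial growth. -/
lemma designOf_entropy (C K : ℕ) :
    K ^ ((designOf C K).seed + 2 * (designOf C K).growTime) ≤
      (designOf C K).M * (K.factorial ^ C) ^ 2 := by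
  have h1 : K ^ (C + 1) ^ 2 ≤ 2 ^ (K * (C + 1) ^ 2) := by
    rw [pow_mul]
    exact Nat.pow_le_pow_left Nat.lt_two_pow_self.le _
  have h2 : K ^ (2 * (C * K)) ≤ 2 ^ (K * (4 * C)) * (K.factorial ^ C) ^ 2 := by
    calc K ^ (2 * (C * K)) = (K ^ K) ^ (2 * C) := by rw [← pow_mul]; congr 1; ring
      _ ≤ (4 ^ K * K.factorial) ^ (2 * C) :=
          Nat.pow_le_pow_left (pow_self_le_four_pow_mul_factorial K) _
      _ = 2 ^ (K * (4 * C)) * (K.factorial ^ C) ^ 2 := by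
          rw [mul_pow, ← pow_mul, ← pow_mul, show (4 : ℕ) = 2 ^ 2 by norm_num, ← pow_mul]
          congr 2 <;> ring
  calc K ^ ((C + 1) ^ 2 + 2 * (C * K)) = K ^ (C + 1) ^ 2 * K ^ (2 * (C * K)) := pow_add _ _ _
    _ ≤ 2 ^ (K * (C + 1) ^ 2) * (2 ^ (K * (4 * C)) * (K.factorial ^ C) ^ 2) :=
        Nat.mul_le_mul h1 h2
    _ = 2 ^ (K * ((C + 1) ^ 2 + 4 * C)) * (K.factorial ^ C) ^ 2 := by
        rw [← mul_assoc, ← pow_add, ← mul_add]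

/-- The constant factor in the bound for the memory time. -/
def timeFactor (C : ℕ) : ℕ := C + 4 * ((C + 1) ^ 2 + 4 * C + 2) + ((C + 1) ^ 2 + 1)

lemma designOf_time_le (C : ℕ) {K : ℕ} (hK : 0 < K) :
    (designOf C K).noiseTime + (designOf C K).closeTime ≤
      timeFactor C * 2 ^ (K * ((C + 1) ^ 2 + 4 * C + 1)) := by
  set M := 2 ^ (K * ((C + 1) ^ 2 + 4 * C)) with hM
  have hM1 : 1 ≤ M := Nat.one_le_two_pow
  have e1 : (designOf C K).noiseTime = C * K +
      4 * ((M - 1) * ((C + 1) ^ 2 + 2 * (C * K) + 2 * (C + K))) := rfl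
  have e2 : (designOf C K).closeTime = (C + 1) * (C + K) + 1 := rfl
  have hKM : K ≤ K * M := Nat.le_mul_of_pos_right K hM1
  have h1 : C * K ≤ C * (K * M) := Nat.mul_le_mul_left C hKM
  have h2 : (M - 1) * ((C + 1) ^ 2 + 2 * (C * K) + 2 * (C + K)) ≤
      M * (((C + 1) ^ 2 + 4 * C + 2) * K) := by
    refine Nat.mul_le_mul (Nat.sub_le _ _) ?_
    have h3 : (C + 1) ^ 2 ≤ (C + 1) ^ 2 * K := Nat.le_mul_of_pos_right _ hK
    have h4 : C ≤ C * K := Nat.le_mul_of_pos_right _ hK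
    nlinarith
  have h3 : (C + 1) * (C + K) + 1 ≤ ((C + 1) ^ 2 + 1) * (K * M) := by
    have h4 : C ≤ C * K := Nat.le_mul_of_pos_right _ hK
    calc (C + 1) * (C + K) + 1 ≤ ((C + 1) ^ 2 + 1) * K := by nlinarith
      _ ≤ _ := Nat.mul_le_mul_left _ hKM
  calc (designOf C K).noiseTime + (designOf C K).closeTime ≤ timeFactor C * (K * M) := by
        rw [e1, e2, timeFactor]
        nlinarith
    _ ≤ timeFactor C * (2 ^ K * M) :=
        Nat.mul_le_mul_left _ (Nat.mul_le_mul_right _ Nat.lt_two_pow_self.le)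
    _ = timeFactor C * 2 ^ (K * ((C + 1) ^ 2 + 4 * C + 1)) := by
        rw [hM, ← pow_add]
        congr 2
        ring

lemma one_div_le_one_add_one_div_log {p : ℝ} (hp₀ : 0 < p) (hp₁ : p < 1) :
    1 / p ≤ 1 + 1 / Real.log (1 / (1 - p)) := by
  have h1 : 0 < 1 - p := by linarith
  have hlog0 : 0 < Real.log (1 / (1 - p)) := Real.log_pos (by rw [lt_div_iff₀ h1]; linarith)
  have hlog : Real.log (1 / (1 - p)) ≤ p / (1 - p) := by
    refine (Real.log_le_sub_one_of_pos (by positivity)).trans (le_of_eq ?_)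
    field_simp
    ring
  have h2 : (1 - p) / p ≤ 1 / Real.log (1 / (1 - p)) := by
    rw [le_div_iff₀ hlog0]
    calc (1 - p) / p * Real.log (1 / (1 - p)) ≤ (1 - p) / p * (p / (1 - p)) :=
          mul_le_mul_of_nonneg_left hlog (by positivity)
      _ = 1 := by field_simp
  have h3 : (1 - p) / p = 1 / p - 1 := by field_simp
  linarith

lemma exists_dominance_ratio {α : ℝ} (hα : 0 < α) :
    ∃ C : ℕ, 2 ≤ C ∧ 60 * (C : ℝ) ^ (-α) < 1 := by
  have h := (tendsto_rpow_neg_atTop hα).comp tendsto_natCast_atTop_atTop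
  have h2 := (h.eventually_lt_const (u := 1 / 60) (by norm_num)).and (eventually_ge_atTop 2)
  obtain ⟨C, h3, h4⟩ := h2.exists
  refine ⟨C, h4, ?_⟩
  simp only [Function.comp_apply] at h3
  linarith

lemma exists_noise_limsup_memoryTime_lt {d : ℕ} (hd : 1 ≤ d) {α : ℝ} (hα : 0 < α)
    {φ : EuclideanSpace ℝ (Fin d) → Dir d} (hφ : RespectsAxes φ)
    {D : ∀ L : ℕ+, (Site d L → ZMod 2) → Chain d L} (hD : HasThreshold D) :
    ∃ a b c : ℝ, 0 < a ∧ 0 < b ∧ 0 < c ∧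
      ∀ p : ℝ, 0 < p → p < 1 →
        ∃ μ : ∀ L : ℕ+, Measure (Noise d L),
          (∀ L, IsProbabilityMeasure (μ L)) ∧
          (∀ L, PBounded p (μ L)) ∧
          (∃ l : ℕ, ∀ L, LocalRange l (μ L)) ∧
          limsup (fun L : ℕ+ => (memoryTime α φ (D L) (μ L) : ℝ≥0∞)) atTop <
            ENNReal.ofReal (a * Real.exp (b / Real.log (1 / (1 - p))) + c) := by
  obtain ⟨C, hC, hCα⟩ := exists_dominance_ratio hα
  let i₀ : Fin d := ⟨0, hd⟩
  set e : ℕ := (C + 1) ^ 2 + 4 * C + 1 with he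
  have hfac : 0 < timeFactor C := by unfold timeFactor; omega
  refine ⟨timeFactor C * Real.exp (2 * e), e, 1, by positivity, by positivity, one_pos,
    fun p hp₀ hp₁ => ?_⟩
  -- `K` is the least integer with `1 / K < p`
  let K : ℕ := ⌊1 / p⌋₊ + 1
  have hK : 0 < K := Nat.succ_pos _
  have hKp : 1 / (K : ℝ) < p := by
    rw [one_div_lt (by positivity) hp₀]
    exact_mod_cast Nat.lt_floor_add_one (1 / p)
  have hKle : (K : ℝ) ≤ 2 + 1 / Real.log (1 / (1 - p)) := by
    have h1 : (⌊1 / p⌋₊ : ℝ) ≤ 1 / p := Nat.floor_le (by positivity)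
    have h2 := one_div_le_one_add_one_div_log hp₀ hp₁
    have h3 : (K : ℝ) = ⌊1 / p⌋₊ + 1 := by simp [K]
    linarith
  set P := designOf C K with hP
  set T := P.noiseTime + P.closeTime with hT
  have hM : (P.C + 1) ^ 2 + 1 ≤ P.M := by
    have h1 : (C + 1) ^ 2 < 2 ^ (C + 1) ^ 2 := Nat.lt_two_pow_self
    have h2 : 2 ^ (C + 1) ^ 2 ≤ 2 ^ (K * ((C + 1) ^ 2 + 4 * C)) := by
      refine Nat.pow_le_pow_right two_pos ?_
      calc (C + 1) ^ 2 ≤ (C + 1) ^ 2 + 4 * C := Nat.le_add_right _ _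
        _ ≤ _ := Nat.le_mul_of_pos_left _ hK
    exact h1.trans_le h2
  have hex := fun L : ℕ+ => exists_noise i₀ hα hφ P hCα hC hK hM (designOf_entropy C K) hKp L
  choose μ hμ1 hμ2 hμ3 hμ4 using hex
  refine ⟨μ, hμ1, hμ2, ⟨P.blockLen, hμ3⟩, ?_⟩
  have hTle : (T : ℝ) ≤
      timeFactor C * Real.exp (2 * e) * Real.exp (e / Real.log (1 / (1 - p))) := by
    have h1 : (T : ℝ) ≤ timeFactor C * 2 ^ (K * e) := by
      exact_mod_cast designOf_time_le C hK
    have h2 : (2 : ℝ) ^ (K * e) ≤ Real.exp (K * e) := by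
      have := pow_le_pow_left₀ (by norm_num : (0 : ℝ) ≤ 2)
        (by linarith [Real.add_one_le_exp 1] : (2 : ℝ) ≤ Real.exp 1) (K * e)
      rwa [← Real.exp_nat_mul, mul_one, Nat.cast_mul] at this
    have h3 : Real.exp (K * e) ≤ Real.exp (2 * e) * Real.exp (e / Real.log (1 / (1 - p))) := by
      rw [← Real.exp_add, Real.exp_le_exp]
      have := mul_le_mul_of_nonneg_right hKle (Nat.cast_nonneg (α := ℝ) e)
      calc (K : ℝ) * e ≤ (2 + 1 / Real.log (1 / (1 - p))) * e := this
        _ = _ := by ring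
    rw [mul_assoc]
    exact h1.trans (mul_le_mul_of_nonneg_left (h2.trans h3) (by positivity))
  have hev : ∀ᶠ L : ℕ+ in atTop, (memoryTime α φ (D L) (μ L) : ℝ≥0∞) ≤ (T : ℝ≥0∞) := by
    filter_upwards [eventually_residual_zero hD,
      eventually_ge_atTop (Nat.toPNat' (10 * P.blockLen + P.blockLen * P.blockLen))] with L hL hL'
    have hL1 : 10 * P.blockLen + P.blockLen * P.blockLen ≤ (L : ℕ) := by
      have h1 : ((Nat.toPNat' (10 * P.blockLen + P.blockLen * P.blockLen) : ℕ+) : ℕ) ≤ L := hL'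
      rw [Nat.toPNat'_coe] at h1
      split_ifs at h1 <;> omega
    have h0 := hμ4 L (by omega) (by omega)
    have hmem : memoryTime α φ (D L) (μ L) ≤ T := by
      refine memoryTime_le (measure_mono_null (fun N hN => ?_) h0)
      intro hline
      rw [Set.mem_ofPred_eq, hline] at hN
      exact residual_lineChain_one_ne_zero i₀ (D L) hL hN
    calc (memoryTime α φ (D L) (μ L) : ℝ≥0∞) ≤ ((T : ℕ∞) : ℝ≥0∞) := by exact_mod_cast hmem
      _ = (T : ℝ≥0∞) := by simp
  refine lt_of_le_of_lt (limsup_le_of_le (by isBoundedDefault) hev) ?_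
  rw [← ENNReal.ofReal_natCast, ENNReal.ofReal_lt_ofReal_iff (by positivity)]
  linarith


end PowerLaw

theorem mainTheorem6 (d : ℕ) (hd : 1 ≤ d) (α : ℝ) (hα : 0 < α) :
    (∀ φ : EuclideanSpace ℝ (Fin d) → PowerLaw.Dir d, PowerLaw.RespectsAxes φ →
      ∀ D : (∀ L : ℕ+, (PowerLaw.Site d L → ZMod 2) → PowerLaw.Chain d L),
        PowerLaw.IsOfflineDecoder D → PowerLaw.HasThreshold D →
        ∃ a b c : ℝ, 0 < a ∧ 0 < b ∧ 0 < c ∧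
          ∀ p : ℝ, 0 < p → p < 1 →
            ∃ μ : ∀ L : ℕ+, Measure (PowerLaw.Noise d L),
              (∀ L, IsProbabilityMeasure (μ L)) ∧
              (∀ L, PowerLaw.PBounded p (μ L)) ∧
              (∃ l : ℕ, ∀ L, PowerLaw.LocalRange l (μ L)) ∧
              limsup (fun L : ℕ+ => (PowerLaw.memoryTime α φ (D L) (μ L) : ℝ≥0∞)) atTop <
                ENNReal.ofReal (a * Real.exp (b / Real.log (1 / (1 - p))) + c)) ∧
    (∀ (p : ℝ) (hp₀ : 0 < p) (hp₁ : p < 1) (r : ℕ), 2 < r →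
      1 - 2 * (1 - p) ^ ⌊(2 : ℝ) ^ (1 / α) * (3 : ℝ) ^ (-(1 / α) - 1) * r⌋₊ ≤
        PowerLaw.bias α ⟨p, hp₀.le, hp₁.le⟩ r) :=
  ⟨fun _ hφ _ _ hD => PowerLaw.exists_noise_limsup_memoryTime_lt hd hα hφ hD,
    fun _ hp₀ hp₁ _ hr => PowerLaw.le_bias hα hp₀ hp₁ (by omega)⟩
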